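/- Let $\Delta>0$ and let $\nu$ be a finite (positive) Borel measure on $\mathbb R$ supported in $[-\Delta,\Delta]$, with Fourier transform $\widehat\nu(x)=\int_{\mathbb R} e^{-2\pi i x\alpha}\,d\nu(\alpha)$. Let $PW(\pi\Delta)$ be the set of entire functions $f:\mathbb C\to\mathbb C$ of exponential type at most $\pi\Delta$ (for every $\varepsilon>0$ there is $C_\varepsilon$ with $|f(z)|\le C_\varepsilon e^{(\pi\Delta+\varepsilon)|z|}$ for all $z\in\mathbb C$) such that $f|_{\mathbb R}\in L^2(\mathbb R)$. Let $\mathcal H_\nu$ be the set of entire functions $f$ of exponential type at most $\pi\Delta$ for which the integral $$\|f\|_\nu^2:=\int_{\mathbb R}|f(x)|^2\,\widehat\nu(x)\,dx$$ converges absolutely. Let $\mathcal A_\Delta$ be the class of continuous even functions $g:\mathbb R\to\mathbb R$ such that $g,\widehat g\in L^1(\mathbb R)$, $\widehat g(\alpha)\le 0$ for $\alpha\in\mathbb R\setminus[-\Delta,\Delta]$, and $g\ge 0$ on $\mathbb R$, where $\widehat g(\alpha)=\int_{\mathbb R}e^{-2\pi i\alpha x}g(x)\,dx$. Put $$\mathbf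 C_\nu:=\inf_{g\in\mathcal A_\Delta,\ g(0)>0}\ \frac1{g(0)}\int_{[-\Delta,\Delta]}\widehat g(\alpha)\,d\nu(\alpha),$$ the infimum being taken in the extended real numbers. Suppose that there are constants $a,b>0$ such that for every $f\in PW(\pi\Delta)$ the number $\|f\|_\nu^2$ is real and nonnegative and $$a\,\|f\|_{L^2(\mathbb R)}\le\|f\|_\nu\le b\,\|f\|_{L^2(\mathbb R)}.$$ Then $\mathcal H_\nu=PW(\pi\Delta)$ as sets. Moreover $\mathcal H_\nu$, with the inner product $\langle f,g\rangle_\nu=\int_{\mathbb R}f(x)\overline{g(x)}\,\widehat\nu(x)\,dx$ and the norm $\|\cdot\|_\nu$, is a reproducing kernel Hilbert space, that is, a Hilbert space of functions on $\mathbb C$ on which $f\mapsto f(w)$ is continuous for every $w\in\mathbb C$. Its reproducing kernel $K_\nu$, defined by $K_\nu(w,\cdot)\in\mathcal H_\nu$ and $f(w)=\langle f,K_\nu(w,\cdot)\rangle_\nu$ for all $f\in\mathcal H_\nu$ and $w\in\mathbb C$, satisfies $K_\nu(0,0)>0$ and $$\mathbf C_\nu\le\frac1{K_\nu(0,0)}.$$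 -/

import Mathlib

open MeasureTheory
open scoped FourierTransform ComplexConjugate

namespace PaleyWiener

/-- `f` is of exponential type at most `τ`: for every `ε > 0` there is a constant `C` with
`|f z| ≤ C * exp ((τ + ε) * |z|)` for all complex `z`. -/
def ExpTypeAtMost (τ : ℝ) (f : ℂ → ℂ) : Prop :=
  ∀ ε : ℝ, 0 < ε → ∃ C : ℝ, ∀ z : ℂ, ‖f z‖ ≤ C * Real.exp ((τ + ε) * ‖z‖)

/-- The Paley-Wiener space `PW(τ)`: entire functions of exponential type at most `τ` whose
restriction to the real line is square integrable. -/
def PW (τ : ℝ) : Set (ℂ → ℂ) :=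
  {f | Differentiable ℂ f ∧ ExpTypeAtMost τ f ∧ MemLp (fun x : ℝ => f x) 2 volume}

/-- The norm of `L²(ℝ)` of the restriction of `f` to the real line. -/
noncomputable def l2Norm (f : ℂ → ℂ) : ℝ :=
  √(∫ x : ℝ, ‖f x‖ ^ 2)

/-- The Fourier transform of a finite measure, `ξ ↦ ∫ exp (-2 π i ξ α) dν(α)`. -/
noncomputable def measureFourier (ν : Measure ℝ) (ξ : ℝ) : ℂ :=
  ∫ α : ℝ, Complex.exp (-2 * Real.pi * Complex.I * ξ * α) ∂ν

/-- The quantity `∫ |f(x)|² ν̂(x) dx`, which is a complex number for a general `ν`. -/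
noncomputable def nuNormSq (ν : Measure ℝ) (f : ℂ → ℂ) : ℂ :=
  ∫ x : ℝ, ((‖f x‖ ^ 2 : ℝ) : ℂ) * measureFourier ν x

/-- `‖f‖_ν`, meaningful when `nuNormSq ν f` is a nonnegative real number. -/
noncomputable def nuNorm (ν : Measure ℝ) (f : ℂ → ℂ) : ℝ :=
  √(nuNormSq ν f).re

/-- The sesquilinear form `⟨f, g⟩_ν = ∫ f(x) conj(g(x)) ν̂(x) dx`. -/
noncomputable def nuForm (ν : Measure ℝ) (f g : ℂ → ℂ) : ℂ :=
  ∫ x : ℝ, f x * conj (g x) * measureFourier ν x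

/-- The set `H_ν` of entire functions of exponential type at most `π Δ` for which the integral of
`|f|² ν̂` over the real line converges (absolutely). -/
def nuSpace (Δ : ℝ) (ν : Measure ℝ) : Set (ℂ → ℂ) :=
  {f | Differentiable ℂ f ∧ ExpTypeAtMost (Real.pi * Δ) f ∧
    Integrable (fun x : ℝ => ((‖f x‖ ^ 2 : ℝ) : ℂ) * measureFourier ν x) volume}

/-- The Fourier transform of a real function `g`. It is real-valued when `g` is even. -/
noncomputable def realFourier (g : ℝ → ℝ) (α : ℝ) : ℝ :=
  (𝓕 (fun x : ℝ => (g x : ℂ)) α).re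

/-- The class `A_Δ` of continuous even functions `g` with `g` and `ĝ` integrable, `ĝ ≤ 0` outside
`[-Δ, Δ]`, and `g ≥ 0`. -/
structure CohnElkiesClass (Δ : ℝ) (g : ℝ → ℝ) : Prop where
  continuous : Continuous g
  even : ∀ x : ℝ, g (-x) = g x
  integrable : Integrable g volume
  integrable_fourier : Integrable (𝓕 (fun x : ℝ => (g x : ℂ))) volume
  fourier_nonpos : ∀ α : ℝ, α ∉ Set.Icc (-Δ) Δ → realFourier g α ≤ 0
  nonneg : ∀ x : ℝ, 0 ≤ g x

/-- The functional `Φ_ν(g)`, the integral of `ĝ` over `[-Δ, Δ]` against `ν`. -/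
noncomputable def phi (Δ : ℝ) (ν : Measure ℝ) (g : ℝ → ℝ) : ℝ :=
  ∫ α in Set.Icc (-Δ) Δ, realFourier g α ∂ν

/-- The constant `C_ν`, the infimum of `Φ_ν(g) / g(0)` over all `g` in `A_Δ` with `g(0) > 0`,
taken in the extended reals. -/
noncomputable def extremalConst (Δ : ℝ) (ν : Measure ℝ) : EReal :=
  sInf {r : EReal | ∃ g : ℝ → ℝ, CohnElkiesClass Δ g ∧ 0 < g 0 ∧
    r = ((phi Δ ν g / g 0 : ℝ) : EReal)}

/-- The reproducing kernel `K(w, z)` of a reproducing kernel Hilbert space of complex-valued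
functions on `ℂ`: the value at `z` of the function `K(w, ·)` which represents evaluation at `w`. -/
noncomputable def reproducingKernel (H : Type*) [NormedAddCommGroup H] [InnerProductSpace ℂ H]
    [CompleteSpace H] [RKHS ℂ H ℂ ℂ] (w z : ℂ) : ℂ :=
  (RKHS.kerFun H w (1 : ℂ) : H) z

end PaleyWiener

/-! Since `ν` has compact support, `ν̂` is Lipschitz. Testing the lower norm bound on translates of
one fixed function of `PW(πΔ)` shows that every window of some length `L` contains a point where
`|ν̂|` is bounded below, hence an interval of fixed length `η` on which `|ν̂| ≥ δ`
(`exists_le_norm_measureFourier`). A Logvinenko-Sereda theorem then makes every `f` of exponential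
type with `|f|² |ν̂|` integrable square integrable, which gives `H_ν ⊆ PW`; the converse holds
because `ν̂` is bounded.

The Logvinenko-Sereda theorem rests on a local estimate. Interpolating `f` at `n` nodes in a nearby
interval and applying the mean value property to the remainder bounds `|f(x)|` by `2⁻ⁿ` times a
circle mean plus `Kⁿ` times an integral over the interval
(`exists_norm_le_circleAverage_add_integral`). Choosing `n` to balance the two terms lowers the
exponential growth rate on the line by a fixed factor; iterating gives boundedness
(`exists_norm_real_le`). With boundedness known, one fixed `n` lets the circle term be absorbed in
sums of squares over translates, with constants independent of `f` (`exists_sum_norm_sq_le`). The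
same square sums give bounded evaluation and completeness, so the equivalent norm turns `PW` into a
reproducing kernel Hilbert space.

For the inequality, put `K = K_ν(0, ·)` and let `g` be the even part of `|K|²` on the line. Moving
the contour in `∫ K(z) conj(K(conj z)) exp(-2πiαz) dz` shows that `ĝ` vanishes off `[-Δ, Δ]`, so `g`
lies in `A_Δ`. By Fubini `Φ_ν(g) = ‖K‖_ν² = K(0,0)`, while `g(0) = K(0,0)²`; the quotient is `1 /
K(0,0)`. -/

namespace PaleyWiener

/-! ### Local estimate by interpolation -/

/-- An entire function vanishing on a finite set is divisible by the corresponding product. -/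
theorem exists_eq_prod_sub_mul (s : Finset ℂ) : ∀ f : ℂ → ℂ, Differentiable ℂ f →
    (∀ z ∈ s, f z = 0) → ∃ G : ℂ → ℂ, Differentiable ℂ G ∧
      ∀ z, f z = (∏ w ∈ s, (z - w)) * G z := by
  induction s using Finset.induction_on with
  | empty => exact fun f hf _ => ⟨f, hf, by simp⟩
  | insert c s hc ih =>
    intro f hf h
    have hd : Differentiable ℂ (dslope f c) := by
      have := (Complex.differentiableOn_dslope (f := f) (c := c) Filter.univ_mem).2
        hf.differentiableOn
      exact differentiableOn_univ.1 this
    have hfc : f c = 0 := h c (by simp)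
    have key : ∀ z, f z = (z - c) * dslope f c z := by
      intro z
      have := sub_smul_dslope f c z
      rw [hfc, sub_zero, smul_eq_mul] at this
      exact this.symm
    obtain ⟨G, hG, hGe⟩ := ih (dslope f c) hd (by
      intro z hz
      have h1 := key z
      rw [h z (by simp [hz])] at h1
      have h2 : z - c ≠ 0 := sub_ne_zero.2 (by rintro rfl; exact hc hz)
      exact (mul_eq_zero.1 h1.symm).resolve_left h2)
    refine ⟨G, hG, fun z => ?_⟩
    rw [key, hGe, Finset.prod_insert hc, mul_assoc]

/-- The denominator of the `j`-th Lagrange basis polynomial at integer nodes: the nodes below `j`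
contribute `j!`, those above contribute `l!`. -/
theorem prod_erase_range_abs_sub (j l : ℕ) :
    ∏ i ∈ (Finset.range (j + l + 1)).erase j, |(j : ℝ) - i| = j.factorial * l.factorial := by
  have h : (Finset.range (j + l + 1)).erase j =
      Finset.range j ∪ (Finset.range l).image (fun i => j + 1 + i) := by
    ext i
    simp only [Finset.mem_erase, Finset.mem_range, Finset.mem_union,
      Finset.mem_image]
    constructor
    · rintro ⟨h1, h2⟩
      rcases lt_or_gt_of_ne h1 with h | h
      · exact Or.inl h
      · exact Or.inr ⟨i - (j + 1), by omega, by omega⟩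
    · rintro (h | ⟨a, ha, rfl⟩) <;> omega
  rw [h, Finset.prod_union]
  · congr 1
    · rw [← Finset.prod_range_reflect, ← Finset.prod_range_add_one_eq_factorial]
      push_cast
      refine Finset.prod_congr rfl fun i hi => ?_
      have : i < j := Finset.mem_range.1 hi
      rw [show ((j - 1 - i : ℕ) : ℝ) = j - 1 - i by
        rw [Nat.cast_sub (by omega), Nat.cast_sub (by omega)]; simp]
      rw [abs_of_nonneg (by ring_nf; positivity)]
      ring
    · rw [Finset.prod_image (fun a _ b _ h => by simpa using h), ← Finset.prod_range_add_one_eq_factorial]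
      push_cast
      refine Finset.prod_congr rfl fun i hi => ?_
      rw [abs_of_nonpos (by have : (0:ℝ) ≤ i := by positivity
                            linarith)]
      ring
  · rw [Finset.disjoint_left]
    simp only [Finset.mem_range, Finset.mem_image, not_exists, not_and]
    intros; omega

/-- A binomial coefficient is at most `2 ^ (j + l)`, and `N ^ N / N! ≤ exp N`. Hence interpolation
loses only a factor exponential in the number of nodes. -/
theorem pow_div_factorial_mul_factorial_le (j l : ℕ) :
    ((j + l + 1 : ℕ) : ℝ) ^ (j + l) / (j.factorial * l.factorial) ≤
      2 ^ (j + l) * Real.exp (j + l + 1 : ℕ) := by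
  have h1 := Real.pow_div_factorial_le_exp ((j + l + 1 : ℕ) : ℝ) (by positivity) (j + l + 1)
  have h2 : ((j + l).choose j : ℝ) ≤ 2 ^ (j + l) := by
    exact_mod_cast Nat.choose_le_two_pow (j + l) j
  have h3 : ((j + l).factorial : ℝ) = (j + l).choose j * (j.factorial * l.factorial) := by
    rw [← Nat.add_choose_mul_factorial_mul_factorial j l, Nat.choose_symm_add]; push_cast; ring
  have h4 : ((j + l + 1 : ℕ) : ℝ) ^ (j + l + 1) / (j + l + 1).factorial =
      ((j + l + 1 : ℕ) : ℝ) ^ (j + l) / (j + l).factorial := by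
    rw [Nat.factorial_succ, pow_succ]
    have : ((j + l + 1 : ℕ) : ℝ) ≠ 0 := by positivity
    push_cast at this ⊢
    field_simp
  rw [h4] at h1
  have h5 : ((j + l + 1 : ℕ) : ℝ) ^ (j + l) / (j.factorial * l.factorial) =
      (j + l).choose j * (((j + l + 1 : ℕ) : ℝ) ^ (j + l) / (j + l).factorial) := by
    rw [h3]
    have : ((j + l).choose j : ℝ) ≠ 0 := by
      have := Nat.choose_pos (n := j + l) (k := j) (by omega)
      positivity
    field_simp
  rw [h5]
  gcongr

/-- Interpolation at equispaced points: the value at `x` of an entire function is controlled by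
its values at the points and a small multiple of its mean on a circle about `x`. -/
theorem norm_le_circleAverage_add_sum {f : ℂ → ℂ} (hf : Differentiable ℂ f) {L h x y : ℝ} (m : ℕ)
    (hh : 0 < h) (hxy : x ≤ y) (hyL : y + m * h ≤ x + L) :
    ‖f x‖ ≤ (1 / 2) ^ (m + 1) * Real.circleAverage (fun z => ‖f z‖) x (3 * L) +
      2 * ((8 * L / (h * (m + 1))) ^ m * Real.exp ((m + 1 : ℕ) : ℝ)) *
        ∑ j ∈ Finset.range (m + 1), ‖f (y + j * h : ℝ)‖ := by
  have hL : 0 ≤ L := by nlinarith [mul_nonneg (Nat.cast_nonneg (α := ℝ) m) hh.le]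
  rcases hL.eq_or_lt with rfl | hL
  · have hz : (m : ℝ) * h = 0 := by
      have := mul_nonneg (Nat.cast_nonneg (α := ℝ) m) hh.le
      linarith
    have hm : m = 0 := by
      rcases mul_eq_zero.1 hz with h0 | h0
      · exact_mod_cast h0
      · exact absurd h0 hh.ne'
    subst hm
    have : x = y := by simp at hyL; linarith
    subst this
    have h2 : (1 : ℝ) ≤ Real.exp 1 := Real.one_le_exp zero_le_one
    simp
    nlinarith [norm_nonneg (f x)]
  set v : ℕ → ℂ := fun j => ((y + j * h : ℝ) : ℂ) with hv
  have hvinj : Function.Injective v := by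
    intro i j hij
    have h1 : y + i * h = y + j * h := Complex.ofReal_injective hij
    have h2 : (i : ℝ) * h = j * h := by linarith
    exact_mod_cast mul_right_cancel₀ hh.ne' h2
  set s := Finset.range (m + 1) with hs
  set P := Lagrange.interpolate s v (fun j => f (v j)) with hP
  set W := (8 * L / (h * (m + 1))) ^ m * Real.exp ((m + 1 : ℕ) : ℝ) with hW
  have hW0 : 0 ≤ W := by positivity
  set S := ∑ j ∈ s, ‖f (v j)‖ with hS
  have hS0 : 0 ≤ S := Finset.sum_nonneg fun _ _ => norm_nonneg _
  have hvx : ∀ j ∈ s, ‖(x : ℂ) - v j‖ ≤ L := by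
    intro j hj
    have hjm : (j : ℝ) ≤ m := by exact_mod_cast Nat.lt_succ_iff.1 (Finset.mem_range.1 hj)
    have h1 : (j : ℝ) * h ≤ m * h := by gcongr
    have h2 : (0 : ℝ) ≤ j * h := by positivity
    rw [hv]
    simp only
    rw [← Complex.ofReal_sub, Complex.norm_real, Real.norm_eq_abs, abs_le]
    constructor <;> linarith
  have hPb : ∀ z : ℂ, ‖z - x‖ ≤ 3 * L → ‖P.eval z‖ ≤ W * S := by
    intro z hz
    rw [hP, Lagrange.interpolate_apply, Polynomial.eval_finsetSum, hS, Finset.mul_sum]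
    refine (norm_sum_le _ _).trans (Finset.sum_le_sum fun j hj => ?_)
    rw [Polynomial.eval_mul, Polynomial.eval_C, norm_mul, mul_comm]
    gcongr
    obtain ⟨l, rfl⟩ : ∃ l, m = j + l := ⟨m - j, by
      have := Finset.mem_range.1 hj; omega⟩
    rw [Lagrange.basis, Polynomial.eval_prod, norm_prod]
    calc ∏ i ∈ s.erase j, ‖(Lagrange.basisDivisor (v j) (v i)).eval z‖
        ≤ ∏ i ∈ s.erase j, ((4 * L / h) / |(j : ℝ) - i|) := by
          refine Finset.prod_le_prod (fun _ _ => norm_nonneg _) fun i hi => ?_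
          have hi' := Finset.mem_of_mem_erase hi
          have hne : (j : ℝ) - i ≠ 0 := sub_ne_zero.2 (by
            exact_mod_cast (Finset.ne_of_mem_erase hi).symm)
          have e1 : v j - v i = (((j : ℝ) - i) * h : ℝ) := by
            simp only [hv]; push_cast; ring
          rw [Lagrange.basisDivisor, Polynomial.eval_mul, Polynomial.eval_C, Polynomial.eval_sub,
            Polynomial.eval_X, Polynomial.eval_C, norm_mul, norm_inv, e1, Complex.norm_real,
            Real.norm_eq_abs, abs_mul, abs_of_pos hh]
          have e2 : ‖z - v i‖ ≤ 4 * L := by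
            calc ‖z - v i‖ = ‖(z - x) + (x - v i)‖ := by ring_nf
              _ ≤ _ := norm_add_le _ _
              _ ≤ 3 * L + L := add_le_add hz (hvx i hi')
              _ = _ := by ring
          have : 0 < |(j : ℝ) - i| := abs_pos.2 hne
          rw [inv_mul_eq_div, div_div, mul_comm h]
          gcongr
      _ = (4 * L / h) ^ (j + l) / (j.factorial * l.factorial) := by
          rw [Finset.prod_div_distrib, Finset.prod_const, hs, prod_erase_range_abs_sub,
            Finset.card_erase_of_mem (hj), Finset.card_range,
            Nat.add_sub_cancel]
      _ = (4 * L / (h * (j + l + 1 : ℕ))) ^ (j + l) *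
            (((j + l + 1 : ℕ) : ℝ) ^ (j + l) / (j.factorial * l.factorial)) := by
          rw [← mul_div_assoc, ← mul_pow]
          congr 2
          have : ((j + l + 1 : ℕ) : ℝ) ≠ 0 := by positivity
          field_simp
      _ ≤ (4 * L / (h * (j + l + 1 : ℕ))) ^ (j + l) *
            (2 ^ (j + l) * Real.exp (j + l + 1 : ℕ)) := by
          gcongr
          exact pow_div_factorial_mul_factorial_le j l
      _ = W := by
          rw [hW, ← mul_assoc, ← mul_pow]
          push_cast
          ring_nf
  have hvinj' : Set.InjOn v (s : Set ℕ) := hvinj.injOn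
  obtain ⟨G, hG, hGe⟩ := exists_eq_prod_sub_mul (s.image v) (fun z => f z - P.eval z)
    (hf.sub P.differentiable) (by
      intro z hz
      obtain ⟨j, hj, rfl⟩ := Finset.mem_image.1 hz
      rw [hP, Lagrange.eval_interpolate_at_node _ hvinj' hj, sub_self])
  simp_rw [Finset.prod_image hvinj'] at hGe
  have hR : |3 * L| = 3 * L := abs_of_pos (by positivity)
  have hcont : Continuous fun z => ‖f z‖ := hf.continuous.norm
  -- On the circle of radius `3L` about `x` every node is at distance at least `2L`, while the nodes
  -- lie within `L` of `x` itself. The quotient of the two nodal products gives the factor `(1 / 2)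
  -- ^ (m + 1)`.
  have hGx : ‖G x‖ ≤ (Real.circleAverage (fun z => ‖f z‖) x (3 * L) + W * S) / (2 * L) ^ (m + 1) := by
    have h1 : Real.circleAverage G x (3 * L) = G x := by
      exact (hG.diffContOnCl).circleAverage
    rw [← h1]
    calc ‖Real.circleAverage G x (3 * L)‖
        ≤ Real.circleAverage (fun z => ‖G z‖) x (3 * L) := by
          rw [Real.circleAverage_def, Real.circleAverage_def, norm_smul, smul_eq_mul,
            Real.norm_of_nonneg (by positivity)]
          gcongr
          exact intervalIntegral.norm_integral_le_integral_norm (by positivity)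
      _ ≤ Real.circleAverage (fun z => (1 / (2 * L) ^ (m + 1)) * (‖f z‖ + W * S)) x (3 * L) := by
          refine Real.circleAverage_mono ?_ ?_ fun z hz => ?_
          · exact (hG.continuous.norm.continuousOn).circleIntegrable'
          · exact (by fun_prop : Continuous fun z =>
              (1 / (2 * L) ^ (m + 1)) * (‖f z‖ + W * S)).continuousOn.circleIntegrable'
          · rw [hR, mem_sphere_iff_norm] at hz
            have h3 : (2 * L) ^ (m + 1) ≤ ‖∏ i ∈ s, (z - v i)‖ := by
              rw [norm_prod, ← Finset.card_range (m + 1), ← hs, ← Finset.prod_const]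
              refine Finset.prod_le_prod (fun _ _ => by positivity) fun i hi => ?_
              have h4 : ‖z - x‖ ≤ ‖z - v i‖ + ‖(x : ℂ) - v i‖ := by
                calc ‖z - x‖ = ‖(z - v i) - (x - v i)‖ := by ring_nf
                  _ ≤ _ := norm_sub_le _ _
              have := hvx i hi
              linarith
            have h5 : ‖∏ i ∈ s, (z - v i)‖ * ‖G z‖ ≤ ‖f z‖ + W * S := by
              rw [← norm_mul, ← hGe]
              exact (norm_sub_le _ _).trans (add_le_add le_rfl (hPb z hz.le))
            rw [one_div, inv_mul_eq_div, le_div_iff₀ (by positivity), mul_comm]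
            exact (mul_le_mul_of_nonneg_right h3 (norm_nonneg _)).trans h5
      _ = _ := by
          have e := Real.circleAverage_fun_smul (a := (1 / (2 * L) ^ (m + 1)))
            (f := fun z => ‖f z‖ + W * S) (c := (x : ℂ)) (R := 3 * L)
          simp only [smul_eq_mul] at e
          rw [e, Real.circleAverage_fun_add, Real.circleAverage_const]
          · ring
          · exact hcont.continuousOn.circleIntegrable'
          · exact continuousOn_const.circleIntegrable'
  have hprod : ‖∏ i ∈ s, ((x : ℂ) - v i)‖ ≤ L ^ (m + 1) := by
    rw [norm_prod, ← Finset.card_range (m + 1), ← hs, ← Finset.prod_const]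
    exact Finset.prod_le_prod (fun _ _ => norm_nonneg _) hvx
  have hA0 : 0 ≤ Real.circleAverage (fun z => ‖f z‖) x (3 * L) :=
    Real.circleAverage_nonneg_of_nonneg fun _ _ => norm_nonneg _
  have hfin : ‖f x‖ ≤ ‖∏ i ∈ s, ((x : ℂ) - v i)‖ * ‖G x‖ + W * S := by
    have := hGe x
    have e : f x = (∏ i ∈ s, ((x : ℂ) - v i)) * G x + P.eval (x : ℂ) := by
      rw [← this]; ring
    rw [e, ← norm_mul]
    exact (norm_add_le _ _).trans (add_le_add le_rfl (hPb x (by simp; positivity)))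
  calc ‖f x‖ ≤ L ^ (m + 1) * ((Real.circleAverage (fun z => ‖f z‖) x (3 * L) + W * S) /
        (2 * L) ^ (m + 1)) + W * S := hfin.trans (by gcongr)
    _ = (1 / 2) ^ (m + 1) * Real.circleAverage (fun z => ‖f z‖) x (3 * L) +
        ((1 / 2) ^ (m + 1) * (W * S) + W * S) := by
        rw [mul_pow, one_div, inv_pow]; field_simp; ring
    _ ≤ _ := by
        have : ((1 : ℝ) / 2) ^ (m + 1) ≤ 1 := pow_le_one₀ (by norm_num) (by norm_num)
        nlinarith [mul_nonneg hW0 hS0]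

/-- Local estimate: an entire function is controlled at `x` by its mean over a circle, with a small
constant, and by its integral over an interval nearby. -/
theorem exists_norm_le_circleAverage_add_integral {L η : ℝ} (hη : 0 < η) (hηL : η ≤ L) :
    ∃ K : ℝ, 2 ≤ K ∧ ∀ (n : ℕ) (f : ℂ → ℂ), Differentiable ℂ f → ∀ x y : ℝ, x ≤ y → y + η ≤ x + L →
      ‖f x‖ ≤ (1 / 2) ^ n * Real.circleAverage (fun z => ‖f z‖) x (3 * L) +
        K ^ n * ∫ u in y..(y + η), ‖f u‖ := by
  have hL : 0 < L := hη.trans_le hηL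
  have hLη : 1 ≤ L / η := (one_le_div hη).2 hηL
  have he : (1 : ℝ) ≤ Real.exp 1 := Real.one_le_exp zero_le_one
  have h16 : 1 ≤ 16 * L / η := by rw [mul_div_assoc]; linarith
  have h4 : 1 ≤ 4 / η + 1 := by have : 0 < 4 / η := by positivity
                                linarith
  refine ⟨(4 / η + 1) * 2 * (16 * L / η) * Real.exp 1, ?_, fun n f hf x y hxy hyL => ?_⟩
  · calc (2 : ℝ) = 1 * 2 * 1 * 1 := by norm_num
      _ ≤ _ := by gcongr
  have hint0 : 0 ≤ ∫ u in y..(y + η), ‖f u‖ :=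
    intervalIntegral.integral_nonneg (by linarith) fun _ _ => norm_nonneg _
  have hfR : Continuous fun u : ℝ => ‖f u‖ := (hf.continuous.comp Complex.continuous_ofReal).norm
  have hA0 : 0 ≤ Real.circleAverage (fun z => ‖f z‖) x (3 * L) :=
    Real.circleAverage_nonneg_of_nonneg fun _ _ => norm_nonneg _
  rcases n with _ | m
  · have h0 : ‖f x‖ ≤ Real.circleAverage (fun z => ‖f z‖) x (3 * L) := by
      have h1 : Real.circleAverage f x (3 * L) = f x := (hf.diffContOnCl).circleAverage
      rw [← h1, Real.circleAverage_def, Real.circleAverage_def, norm_smul, smul_eq_mul,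
        Real.norm_of_nonneg (by positivity)]
      gcongr
      exact intervalIntegral.norm_integral_le_integral_norm (by positivity)
    simp only [pow_zero, one_mul]
    linarith
  set A := Real.circleAverage (fun z => ‖f z‖) x (3 * L) with hA
  -- The nodes then span at most `η / 2`, so the whole grid can be shifted by any `t ∈ [0, η / 2]`
  -- inside the interval. Averaging over `t` replaces point values by the integral.
  set h := η / (2 * (m + 1)) with hh
  have hh0 : 0 < h := by positivity
  have hmh : m * h ≤ η / 2 := by
    rw [hh, ← mul_div_assoc, div_le_div_iff₀ (by positivity) (by positivity)]
    nlinarith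
  set W := (8 * L / (h * (m + 1))) ^ m * Real.exp ((m + 1 : ℕ) : ℝ) with hW
  have hW0 : 0 ≤ W := by positivity
  have hpt : ∀ t ∈ Set.Icc (0 : ℝ) (η / 2), ‖f x‖ ≤ (1 / 2) ^ (m + 1) * A +
      2 * W * ∑ j ∈ Finset.range (m + 1), ‖f (t + (y + j * h) : ℝ)‖ := by
    intro t ht
    have := norm_le_circleAverage_add_sum hf (L := L) (h := h) (x := x) (y := y + t) m hh0
      (by linarith [ht.1]) (by linarith [ht.2])
    convert this using 6 with j
    ring_nf
  have hcj : ∀ j : ℕ, Continuous fun t : ℝ => ‖f (t + (y + j * h) : ℝ)‖ := fun j =>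
    hfR.comp (continuous_id.add continuous_const)
  have hmono := intervalIntegral.integral_mono_on (a := 0) (b := η / 2) (μ := volume)
    (f := fun _ => ‖f x‖) (by linarith)
    (continuous_const.intervalIntegrable _ _)
    (Continuous.intervalIntegrable (by
      exact continuous_const.add (continuous_const.mul (continuous_finsetSum _ fun j _ => hcj j))) _ _)
    hpt
  rw [intervalIntegral.integral_const, intervalIntegral.integral_add
    (continuous_const.intervalIntegrable _ _) (Continuous.intervalIntegrable (by
      exact (continuous_const.mul (continuous_finsetSum _ fun j _ => hcj j))) _ _),
    intervalIntegral.integral_const, intervalIntegral.integral_const_mul,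
    intervalIntegral.integral_finsetSum (fun j _ => (hcj j).intervalIntegrable _ _)] at hmono
  have hsum : ∑ j ∈ Finset.range (m + 1), ∫ t in (0 : ℝ)..(η / 2), ‖f (t + (y + j * h) : ℝ)‖ ≤
      (m + 1) * ∫ u in y..(y + η), ‖f u‖ := by
    have : ∀ j ∈ Finset.range (m + 1), ∫ t in (0 : ℝ)..(η / 2), ‖f (t + (y + j * h) : ℝ)‖ ≤
        ∫ u in y..(y + η), ‖f u‖ := by
      intro j hj
      have hjm : (j : ℝ) ≤ m := by exact_mod_cast Nat.lt_succ_iff.1 (Finset.mem_range.1 hj)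
      have hj0 : (0 : ℝ) ≤ j * h := by positivity
      have hjh : (j : ℝ) * h ≤ m * h := by gcongr
      rw [intervalIntegral.integral_comp_add_right (fun u : ℝ => ‖f u‖)]
      exact intervalIntegral.integral_mono_interval (by linarith) (by linarith) (by linarith)
        (Filter.Eventually.of_forall fun _ => norm_nonneg _) (hfR.intervalIntegrable _ _)
    calc _ ≤ _ := Finset.sum_le_sum this
      _ = _ := by simp
  simp only [sub_zero, smul_eq_mul] at hmono
  have hK : 4 / η * (m + 1) * W ≤ ((4 / η + 1) * 2 * (16 * L / η) * Real.exp 1) ^ (m + 1) := by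
    rw [mul_pow, mul_pow, mul_pow]
    have e1 : 4 / η ≤ (4 / η + 1) ^ (m + 1) :=
      (by linarith : 4 / η ≤ 4 / η + 1).trans (le_self_pow₀ h4 (by omega))
    have e2 : ((m : ℝ) + 1) ≤ 2 ^ (m + 1) := by
      exact_mod_cast (Nat.lt_two_pow_self (n := m + 1)).le
    have e3 : W ≤ (16 * L / η) ^ (m + 1) * Real.exp 1 ^ (m + 1) := by
      rw [hW, ← Real.exp_nat_mul, mul_one]
      have : 8 * L / (h * (m + 1)) = 16 * L / η := by rw [hh]; field_simp; norm_num
      rw [this]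
      gcongr ?_ * _
      exact pow_le_pow_right₀ h16 (by omega)
    rw [mul_assoc ((4 / η + 1) ^ (m + 1) * 2 ^ (m + 1))]
    gcongr
  have hfin : ‖f x‖ ≤ (1 / 2) ^ (m + 1) * A + 4 / η * (m + 1) * W * ∫ u in y..(y + η), ‖f u‖ := by
    have h1 : η / 2 * ‖f x‖ ≤ η / 2 * ((1 / 2) ^ (m + 1) * A) +
        2 * W * ((m + 1) * ∫ u in y..(y + η), ‖f u‖) := hmono.trans (by gcongr)
    have h2 : η / 2 * ‖f x‖ ≤ η / 2 * ((1 / 2) ^ (m + 1) * A +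
        4 / η * (m + 1) * W * ∫ u in y..(y + η), ‖f u‖) := by
      refine h1.trans (le_of_eq ?_)
      field_simp
      ring
    exact le_of_mul_le_mul_left h2 (by positivity)
  exact hfin.trans (by gcongr)

/-- If `v ≤ 2⁻ⁿ M + Kⁿ` for all `n`, then `v` is bounded by a power of `M` less than one. -/
theorem exists_le_rpow_of_forall_le {K : ℝ} (hK : 2 ≤ K) : ∃ θ : ℝ, 0 < θ ∧ θ < 1 ∧
    ∀ v M : ℝ, 1 ≤ M → (∀ n : ℕ, v ≤ (1 / 2) ^ n * M + K ^ n) → v ≤ 3 * M ^ (1 - θ) := by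
  have h2 : 0 < Real.log 2 := Real.log_pos (by norm_num)
  have hK0 : 0 < K := by linarith
  have hlK : 0 < Real.log K := Real.log_pos (by linarith)
  -- With `n = β log M` the terms `2⁻ⁿ M` and `Kⁿ` both equal `M ^ (1 - θ)`, where `θ = β log 2`.
  -- Rounding `n` down costs a factor `2` in the first, whence the constant `3`.
  set β := 1 / (Real.log K + Real.log 2) with hβ
  have hβ0 : 0 < β := by positivity
  have hsum : β * Real.log K + β * Real.log 2 = 1 := by rw [hβ]; field_simp
  refine ⟨β * Real.log 2, by positivity, ?_, fun v M hM h => ?_⟩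
  · have : 0 < β * Real.log K := by positivity
    linarith
  have hM0 : 0 < M := by linarith
  have hlM : 0 ≤ Real.log M := Real.log_nonneg hM
  set n := ⌊β * Real.log M⌋₊ with hn
  have hn1 : (n : ℝ) ≤ β * Real.log M := Nat.floor_le (by positivity)
  have hn2 : β * Real.log M < n + 1 := Nat.lt_floor_add_one _
  have e1 : ((1 : ℝ) / 2) ^ n * M ≤ 2 * M ^ (1 - β * Real.log 2) := by
    have a1 : ((1 : ℝ) / 2) ^ n = Real.exp (-(n * Real.log 2)) := by
      rw [Real.exp_neg, Real.exp_nat_mul, Real.exp_log (by norm_num), one_div, inv_pow]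
    have a2 : (2 : ℝ) = Real.exp (Real.log 2) := (Real.exp_log (by norm_num)).symm
    have a3 : Real.exp (-(n * Real.log 2)) * M = Real.exp (-(n * Real.log 2) + Real.log M) := by
      rw [Real.exp_add, Real.exp_log hM0]
    have a4 : 2 * Real.exp (Real.log M * (1 - β * Real.log 2)) =
        Real.exp (Real.log 2 + Real.log M * (1 - β * Real.log 2)) := by
      rw [Real.exp_add, ← a2]
    rw [a1, Real.rpow_def_of_pos hM0, a3, a4]
    apply Real.exp_le_exp.2
    nlinarith
  have e2 : K ^ n ≤ M ^ (1 - β * Real.log 2) := by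
    have a1 : K ^ n = Real.exp (n * Real.log K) := by
      rw [Real.exp_nat_mul, Real.exp_log hK0]
    rw [a1, Real.rpow_def_of_pos hM0]
    apply Real.exp_le_exp.2
    have : 1 - β * Real.log 2 = β * Real.log K := by linarith
    rw [this]
    nlinarith
  linarith [h n]

/-! ### Phragmén-Lindelöf estimates -/

/-- Phragmén-Lindelöf in a quadrant for a function of exponential type. -/
theorem norm_le_of_quadrant {f : ℂ → ℂ} (hf : Differentiable ℂ f) {C M s σ : ℝ} (hs : 0 ≤ s)
    (hσ : 0 ≤ σ) (hC : ∀ z, ‖f z‖ ≤ C * Real.exp (σ * ‖z‖)) (hCM : C ≤ M)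
    (hM : ∀ x : ℝ, ‖f x‖ ≤ M * Real.exp (s * |x|)) {z : ℂ} (hre : 0 ≤ z.re) (him : 0 ≤ z.im) :
    ‖f z‖ ≤ M * Real.exp (s * z.re + σ * z.im) := by
  have hnorm : ∀ w : ℂ, ‖f w * Complex.exp (-(s * w) + Complex.I * σ * w)‖ =
      ‖f w‖ * Real.exp (-(s * w.re + σ * w.im)) := by
    intro w
    rw [norm_mul, Complex.norm_exp]
    congr 2
    simp
    ring
  -- The multiplier has modulus `exp(-(s Re w + σ Im w))`, which cancels the growth on both sides of
  -- the quadrant and leaves the bound `M` there.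
  have hg := PhragmenLindelof.quadrant_I (C := M) (z := z)
    (f := fun w => f w * Complex.exp (-(s * w) + Complex.I * σ * w))
    (Differentiable.diffContOnCl (by fun_prop)) ⟨1, by norm_num, σ, ?_⟩ ?_ ?_ hre him
  · rw [hnorm, Real.exp_neg, ← div_eq_mul_inv, div_le_iff₀ (Real.exp_pos _)] at hg
    exact hg
  · refine Asymptotics.IsBigO.of_bound C ?_
    filter_upwards [Filter.mem_inf_of_right (Filter.mem_principal_self _)] with w hw
    have h1 : 0 < w.re := hw.1
    have h2 : 0 < w.im := hw.2
    rw [hnorm, Real.rpow_one, Real.norm_of_nonneg (Real.exp_pos _).le]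
    calc _ ≤ ‖f w‖ * 1 := by
          gcongr
          rw [Real.exp_le_one_iff]
          have := mul_nonneg hs h1.le
          have := mul_nonneg hσ h2.le
          linarith
      _ ≤ _ := by rw [mul_one]; exact hC w
  · intro x hx
    rw [hnorm]
    have := hM x
    rw [abs_of_nonneg hx] at this
    simp only [Complex.ofReal_re, Complex.ofReal_im, mul_zero, add_zero]
    rwa [Real.exp_neg, ← div_eq_mul_inv, div_le_iff₀ (Real.exp_pos _)]
  · intro x hx
    rw [hnorm]
    have := hC (x * Complex.I)
    simp only [norm_mul, Complex.norm_real, Complex.norm_I, mul_one, Real.norm_of_nonneg hx] at this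
    simp only [Complex.mul_re, Complex.ofReal_re, Complex.I_re, mul_zero, Complex.ofReal_im,
      Complex.I_im, mul_one, sub_self, Complex.mul_im, zero_add, add_zero]
    rw [Real.exp_neg, ← div_eq_mul_inv, div_le_iff₀ (Real.exp_pos _)]
    exact this.trans (by gcongr)

theorem differentiable_conj_conj {g : ℂ → ℂ} (hg : Differentiable ℂ g) :
    Differentiable ℂ fun w => conj (g (conj w)) := by
  intro w
  have := (hg (conj w)).conj_conj
  rwa [Complex.conj_conj] at this

/-- The hypotheses are invariant under `f(z) ↦ f(-z)` and `f(z) ↦ conj (f(conj z))`, which carry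
every quadrant to the first. -/
theorem norm_le_exp_of_norm_real_le {f : ℂ → ℂ} (hf : Differentiable ℂ f) {C M s σ : ℝ}
    (hs : 0 ≤ s) (hσ : 0 ≤ σ) (hC : ∀ z, ‖f z‖ ≤ C * Real.exp (σ * ‖z‖)) (hCM : C ≤ M)
    (hM : ∀ x : ℝ, ‖f x‖ ≤ M * Real.exp (s * |x|)) (z : ℂ) :
    ‖f z‖ ≤ M * Real.exp (s * |z.re| + σ * |z.im|) := by
  have upper : ∀ g : ℂ → ℂ, Differentiable ℂ g → (∀ z, ‖g z‖ ≤ C * Real.exp (σ * ‖z‖)) →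
      (∀ x : ℝ, ‖g x‖ ≤ M * Real.exp (s * |x|)) → ∀ z : ℂ, 0 ≤ z.re →
      ‖g z‖ ≤ M * Real.exp (s * z.re + σ * |z.im|) := by
    intro g hg hgC hgM z hz
    rcases le_total 0 z.im with h | h
    · rw [abs_of_nonneg h]
      exact norm_le_of_quadrant hg hs hσ hgC hCM hgM hz h
    · have := norm_le_of_quadrant (f := fun w => conj (g (conj w))) (C := C) (M := M)
        (s := s) (σ := σ) (z := conj z) (differentiable_conj_conj hg) hs hσ
        (fun w => by simpa using hgC (conj w)) hCM (fun x => by simpa using hgM x)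
        (by simpa using hz) (by simpa using h)
      rw [abs_of_nonpos h]
      simpa using this
  rcases le_total 0 z.re with h | h
  · rw [abs_of_nonneg h]
    exact upper f hf hC hM z h
  · have := upper (fun w => f (-w)) (hf.comp differentiable_neg)
      (fun w => by simpa using hC (-w)) (fun x => by simpa using hM (-x)) (-z) (by simpa using h)
    rw [abs_of_nonpos h]
    simpa using this

/-- Phragmén-Lindelöf in a half-plane: a function of exponential type bounded on the real line. -/
theorem norm_le_exp_abs_im {E : Type*} [NormedAddCommGroup E] [NormedSpace ℂ E] {F : ℂ → E}
    (hF : Differentiable ℂ F) {C S σ : ℝ} (hσ : 0 ≤ σ) (hC : ∀ z, ‖F z‖ ≤ C * Real.exp (σ * ‖z‖))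
    (hS : ∀ x : ℝ, ‖F x‖ ≤ S) (z : ℂ) : ‖F z‖ ≤ S * Real.exp (σ * |z.im|) := by
  have upper : ∀ G : ℂ → E, Differentiable ℂ G → (∀ z, ‖G z‖ ≤ C * Real.exp (σ * ‖z‖)) →
      (∀ x : ℝ, ‖G x‖ ≤ S) → ∀ z : ℂ, 0 ≤ z.im → ‖G z‖ ≤ S * Real.exp (σ * z.im) := by
    intro G hG hGC hGS z hz
    have hnorm : ∀ w : ℂ, ‖Complex.exp (-(σ * w)) • G (Complex.I * w)‖ =
        Real.exp (-(σ * w.re)) * ‖G (Complex.I * w)‖ := by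
      intro w
      rw [norm_smul, Complex.norm_exp]
      congr 2
      simp
    have hb : ∀ w : ℂ, ‖G (Complex.I * w)‖ ≤ C * Real.exp (σ * ‖w‖) := fun w => by
      simpa using hGC (Complex.I * w)
    have h := PhragmenLindelof.right_half_plane_of_bounded_on_real (C := S)
      (f := fun w => Complex.exp (-(σ * w)) • G (Complex.I * w)) (z := -Complex.I * z)
      (Differentiable.diffContOnCl (by fun_prop)) ⟨1, by norm_num, σ, ?_⟩ ?_ ?_ (by simpa using hz)
    · rw [hnorm, Real.exp_neg, inv_mul_le_iff₀ (Real.exp_pos _)] at h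
      have e : Complex.I * (-Complex.I * z) = z := by
        rw [← mul_assoc]; simp
      rw [e] at h
      rw [mul_comm]
      simpa using h
    · refine Asymptotics.IsBigO.of_bound C ?_
      filter_upwards [Filter.mem_inf_of_right (Filter.mem_principal_self _)] with w hw
      have h1 : 0 < w.re := hw
      rw [hnorm, Real.rpow_one, Real.norm_of_nonneg (Real.exp_pos _).le]
      calc _ ≤ 1 * ‖G (Complex.I * w)‖ := by
            gcongr
            rw [Real.exp_le_one_iff]
            have := mul_nonneg hσ h1.le
            linarith
        _ ≤ _ := by rw [one_mul]; exact hb w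
    · refine ⟨C, ?_⟩
      rw [Filter.eventually_map]
      filter_upwards [Filter.eventually_ge_atTop (0 : ℝ)] with x hx
      rw [hnorm, Real.exp_neg, inv_mul_le_iff₀ (Real.exp_pos _), mul_comm (Real.exp _)]
      have := hb x
      simpa [abs_of_nonneg hx] using this
    · intro x
      rw [hnorm]
      have e : Complex.I * (x * Complex.I) = ((-x : ℝ) : ℂ) := by
        rw [mul_left_comm, Complex.I_mul_I]; simp
      rw [e]
      simpa using hGS (-x)
  rcases le_total 0 z.im with h | h
  · rw [abs_of_nonneg h]
    exact upper F hF hC hS z h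
  · have := upper (fun w => F (-w)) (hF.comp differentiable_neg) (fun w => by simpa using hC (-w))
      (fun x => by simpa using hS (-x)) (-z) (by simpa using h)
    rw [abs_of_nonpos h]
    simpa using this

/-! ### Boundedness on the real line -/

/-- A function of exponential type whose integrals over a relatively dense family of intervals are
bounded is bounded on the real line. -/
theorem exists_norm_real_le {f : ℂ → ℂ} (hf : Differentiable ℂ f) {C σ L η A : ℝ} (hσ : 0 ≤ σ)
    (hC : ∀ z, ‖f z‖ ≤ C * Real.exp (σ * ‖z‖)) (hη : 0 < η) (hηL : η ≤ L)
    (hA : ∀ x : ℝ, ∃ y, x ≤ y ∧ y + η ≤ x + L ∧ ∫ u in y..(y + η), ‖f u‖ ≤ A) :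
    ∃ S : ℝ, ∀ x : ℝ, ‖f x‖ ≤ S := by
  have hL : 0 < L := hη.trans_le hηL
  have hA0 : 0 ≤ A := by
    obtain ⟨y, -, -, h⟩ := hA 0
    exact (intervalIntegral.integral_nonneg (by linarith) fun _ _ => norm_nonneg _).trans h
  obtain ⟨K, hK, hloc⟩ := exists_norm_le_circleAverage_add_integral hη hηL
  obtain ⟨θ, hθ0, hθ1, hθ⟩ := exists_le_rpow_of_forall_le hK
  -- `c` pays for moving from `x` to the circle of radius `3L`, in both coordinates. `M` is so large
  -- that `M ^ θ` absorbs all constants: each step of the induction keeps `M` and multiplies the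
  -- growth rate by `1 - θ`.
  set c := 6 * σ * L with hc
  have hc0 : 0 ≤ c := by positivity
  set M := max (max C 1) ((3 * (A + 1) * Real.exp c) ^ (1 / θ)) with hM
  have hMC : C ≤ M := (le_max_left _ _).trans (le_max_left _ _)
  have hM1 : 1 ≤ M := (le_max_right _ _).trans (le_max_left _ _)
  have hM0 : 0 < M := by linarith
  have hMθ : 3 * (A + 1) * Real.exp c ≤ M ^ θ := by
    have h0 : 0 ≤ 3 * (A + 1) * Real.exp c := by positivity
    calc _ = ((3 * (A + 1) * Real.exp c) ^ (1 / θ)) ^ θ := by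
          rw [← Real.rpow_mul h0, one_div_mul_cancel hθ0.ne', Real.rpow_one]
      _ ≤ _ := Real.rpow_le_rpow (by positivity) (le_max_right _ _) hθ0.le
  have hind : ∀ m : ℕ, ∀ x : ℝ, ‖f x‖ ≤ M * Real.exp (σ * (1 - θ) ^ m * |x|) := by
    intro m
    induction m with
    | zero =>
      intro x
      have := hC x
      rw [Complex.norm_real, Real.norm_eq_abs] at this
      rw [pow_zero, mul_one]
      exact this.trans (by gcongr)
    | succ m ih =>
      intro x
      have hp1 : (1 - θ) ^ m ≤ 1 := pow_le_one₀ (by linarith) (by linarith)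
      have hp0 : 0 ≤ (1 - θ) ^ m := pow_nonneg (by linarith) _
      set s := σ * (1 - θ) ^ m with hs
      have hs0 : 0 ≤ s := by positivity
      have hsσ : s ≤ σ := mul_le_of_le_one_right hσ hp1
      have hall := norm_le_exp_of_norm_real_le hf hs0 hσ hC hMC ih
      set D := M * Real.exp (s * |x| + c) with hD
      have hD1 : 1 ≤ D := one_le_mul_of_one_le_of_one_le hM1 (Real.one_le_exp (by positivity))
      have havg : Real.circleAverage (fun z => ‖f z‖) x (3 * L) ≤ D := by
        refine Real.circleAverage_mono_on_of_le_circle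
          hf.continuous.norm.continuousOn.circleIntegrable' fun z hz => ?_
        rw [abs_of_pos (by positivity), mem_sphere_iff_norm] at hz
        have h1 := Complex.abs_re_le_norm (z - x)
        have h2 := Complex.abs_im_le_norm (z - x)
        rw [hz] at h1 h2
        simp only [Complex.sub_re, Complex.ofReal_re, Complex.sub_im, Complex.ofReal_im,
          sub_zero] at h1 h2
        have h3 : |z.re| ≤ |x| + 3 * L := by
          have := abs_add_le (z.re - x) x
          rw [sub_add_cancel] at this
          linarith
        refine (hall z).trans ?_
        rw [hD]
        have e1 : s * |z.re| ≤ s * (|x| + 3 * L) := by gcongr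
        have e2 : σ * |z.im| ≤ σ * (3 * L) := by gcongr
        have e3 : s * (3 * L) ≤ σ * (3 * L) := by gcongr
        refine mul_le_mul_of_nonneg_left (Real.exp_le_exp.2 ?_) hM0.le
        linarith
      obtain ⟨y, hxy, hyL, hyA⟩ := hA x
      have hv := hθ (‖f x‖ / (A + 1)) D hD1 (fun n => by
        rw [div_le_iff₀ (by linarith)]
        have hKn : 0 < K ^ n := by positivity
        calc ‖f x‖ ≤ (1 / 2) ^ n * D + K ^ n * A := (hloc n f hf x y hxy hyL).trans (by gcongr)
          _ ≤ (1 / 2) ^ n * D * (A + 1) + K ^ n * (A + 1) := by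
            have : 0 ≤ (1 / 2) ^ n * D * A := by positivity
            nlinarith
          _ = _ := by ring)
      rw [div_le_iff₀ (by linarith)] at hv
      calc ‖f x‖ ≤ 3 * D ^ (1 - θ) * (A + 1) := hv
        _ = 3 * (A + 1) * Real.exp (c * (1 - θ)) * M ^ (1 - θ) *
              Real.exp (σ * (1 - θ) ^ (m + 1) * |x|) := by
            rw [hD, Real.mul_rpow hM0.le (Real.exp_pos _).le, ← Real.exp_mul, add_mul, Real.exp_add,
              hs, pow_succ]
            ring_nf
        _ ≤ M ^ θ * M ^ (1 - θ) * Real.exp (σ * (1 - θ) ^ (m + 1) * |x|) := by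
            gcongr
            refine le_trans ?_ hMθ
            gcongr
            nlinarith
        _ = _ := by
            rw [← Real.rpow_add hM0, add_sub_cancel, Real.rpow_one]
  refine ⟨M, fun x => ?_⟩
  have hlim : Filter.Tendsto (fun m : ℕ => M * Real.exp (σ * (1 - θ) ^ m * |x|)) Filter.atTop
      (nhds (M * Real.exp (σ * 0 * |x|))) := by
    have := tendsto_pow_atTop_nhds_zero_of_lt_one (r := 1 - θ) (by linarith) (by linarith)
    exact ((Real.continuous_exp.tendsto _).comp ((this.const_mul σ).mul_const _)).const_mul M
  have := ge_of_tendsto' hlim (fun m => hind m x)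
  simpa using this

/-! ### Square sums over translates and the Logvinenko-Sereda inequality -/

/-- Cauchy-Schwarz against the constant function, read off from the variance being nonnegative. -/
theorem sq_intervalIntegral_le {g : ℝ → ℝ} (hg : Continuous g) {a b : ℝ} (hab : a ≤ b) :
    (∫ t in a..b, g t) ^ 2 ≤ (b - a) * ∫ t in a..b, g t ^ 2 := by
  rcases hab.eq_or_lt with rfl | h
  · simp
  set I := ∫ t in a..b, g t with hI
  have h0 : 0 ≤ ∫ t in a..b, ((b - a) * g t - I) ^ 2 :=
    intervalIntegral.integral_nonneg hab fun _ _ => sq_nonneg _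
  have h1 : ∫ t in a..b, ((b - a) * g t - I) ^ 2 =
      (b - a) ^ 2 * (∫ t in a..b, g t ^ 2) - (2 * (b - a) * I) * I + (b - a) * I ^ 2 := by
    have e : ∀ t, ((b - a) * g t - I) ^ 2 =
        (b - a) ^ 2 * g t ^ 2 - (2 * (b - a) * I) * g t + I ^ 2 := fun t => by ring
    simp_rw [e]
    rw [intervalIntegral.integral_add, intervalIntegral.integral_sub,
      intervalIntegral.integral_const_mul, intervalIntegral.integral_const_mul,
      intervalIntegral.integral_const, smul_eq_mul]
    all_goals exact Continuous.intervalIntegrable (by fun_prop) _ _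
  rw [h1] at h0
  have h2 : 0 ≤ (b - a) * ((b - a) * (∫ t in a..b, g t ^ 2) - I ^ 2) := by linarith
  have := nonneg_of_mul_nonneg_right h2 (sub_pos.2 h)
  linarith

theorem sq_circleAverage_le {g : ℂ → ℝ} (hg : Continuous g) (c : ℂ) (R : ℝ) :
    Real.circleAverage g c R ^ 2 ≤ Real.circleAverage (fun z => g z ^ 2) c R := by
  rw [Real.circleAverage_def, Real.circleAverage_def, smul_eq_mul, smul_eq_mul, mul_pow]
  have h := sq_intervalIntegral_le (g := fun θ => g (circleMap c R θ)) (by fun_prop)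
    Real.two_pi_pos.le
  have hp := Real.two_pi_pos
  calc _ ≤ (2 * Real.pi)⁻¹ ^ 2 * _ := mul_le_mul_of_nonneg_left h (by positivity)
    _ = _ := by rw [sub_zero]; field_simp

/-- A discrete Plancherel-Pólya and Logvinenko-Sereda inequality. -/
theorem exists_sum_norm_sq_le {σ L η : ℝ} (hσ : 0 ≤ σ) (hη : 0 < η) (hηL : η ≤ L) :
    ∃ B : ℝ, 0 ≤ B ∧ ∀ (f : ℂ → ℂ) (C S A : ℝ), Differentiable ℂ f →
      (∀ z, ‖f z‖ ≤ C * Real.exp (σ * ‖z‖)) → (∀ x : ℝ, ‖f x‖ ≤ S) →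
      (∀ x : ℝ, ∃ y : ℤ → ℝ, (∀ k, x + k * L ≤ y k ∧ y k + η ≤ x + k * L + L) ∧
        ∀ F : Finset ℤ, ∑ k ∈ F, ∫ u in (y k)..(y k + η), ‖f u‖ ^ 2 ≤ A) →
      ∀ (F : Finset ℤ) (z : ℂ),
        ∑ k ∈ F, ‖f (z + (k * L : ℝ))‖ ^ 2 ≤ B * A * Real.exp (2 * σ * |z.im|) := by
  have hL : 0 < L := hη.trans_le hηL
  obtain ⟨K, hK, hloc⟩ := exists_norm_le_circleAverage_add_integral hη hηL
  -- `n` makes the circle term at most half of the supremum `T` below, so that it can be absorbed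
  -- into the left side.
  obtain ⟨n, hn⟩ : ∃ n : ℕ, (2 * Real.exp (2 * σ * (3 * L))) * (1 / 4) ^ n ≤ 1 / 2 := by
    have := (tendsto_pow_atTop_nhds_zero_of_lt_one (r := (1 / 4 : ℝ)) (by norm_num)
      (by norm_num)).const_mul (2 * Real.exp (2 * σ * (3 * L)))
    rw [mul_zero] at this
    exact (this.eventually (ge_mem_nhds (by norm_num : (0 : ℝ) < 1 / 2))).exists
  refine ⟨4 * (K ^ n) ^ 2 * η, by positivity, fun f C S A hf hC hS hA F => ?_⟩
  -- Absorption needs `T` finite, which holds because `F` is finite and `f` is bounded on the line.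
  -- Neither `F` nor `S` enters the final bound.
  set T := ⨆ x : ℝ, ∑ k ∈ F, ‖f ((x : ℂ) + (k * L : ℝ))‖ ^ 2 with hT
  have hbdd : BddAbove (Set.range fun x : ℝ => ∑ k ∈ F, ‖f ((x : ℂ) + (k * L : ℝ))‖ ^ 2) := by
    refine ⟨∑ k ∈ F, S ^ 2, ?_⟩
    rintro _ ⟨x, rfl⟩
    refine Finset.sum_le_sum fun k _ => ?_
    have := hS (x + k * L)
    push_cast at this ⊢
    gcongr
  have hTx : ∀ x : ℝ, ∑ k ∈ F, ‖f ((x : ℂ) + (k * L : ℝ))‖ ^ 2 ≤ T := fun x => le_ciSup hbdd x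
  have hT0 : 0 ≤ T := (Finset.sum_nonneg fun _ _ => sq_nonneg _).trans (hTx 0)
  have hTz : ∀ z : ℂ, ∑ k ∈ F, ‖f (z + (k * L : ℝ))‖ ^ 2 ≤ T * Real.exp (2 * σ * |z.im|) := by
    -- The square sum is the squared norm of one vector-valued entire function, so Phragmén-Lindelöf
    -- bounds it as a whole, without a loss depending on the size of `F`.
    let G : ℂ → EuclideanSpace ℂ F := fun z => WithLp.toLp 2 fun k => f (z + ((k : ℤ) * L : ℝ))
    have hG : Differentiable ℂ G := by
      rw [differentiable_euclidean]
      intro k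
      exact hf.comp (differentiable_id.add_const _)
    have hGn : ∀ z, ‖G z‖ ^ 2 = ∑ k ∈ F, ‖f (z + (k * L : ℝ))‖ ^ 2 := by
      intro z
      rw [EuclideanSpace.norm_sq_eq, ← Finset.sum_coe_sort F]
    have hGC : ∀ z, ‖G z‖ ≤ √(∑ k ∈ F, (C * Real.exp (σ * ‖((k * L : ℝ) : ℂ)‖)) ^ 2) *
        Real.exp (σ * ‖z‖) := by
      intro z
      rw [← abs_of_nonneg (norm_nonneg (G z))]
      refine abs_le_of_sq_le_sq ?_ (by positivity)
      rw [hGn, mul_pow, Real.sq_sqrt (Finset.sum_nonneg fun _ _ => sq_nonneg _), Finset.sum_mul]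
      refine Finset.sum_le_sum fun k _ => ?_
      rw [← mul_pow]
      have hC0 : 0 ≤ C := by
        have := (norm_nonneg _).trans (hC 0)
        simpa using this
      gcongr
      rw [mul_assoc, ← Real.exp_add, ← mul_add]
      refine (hC _).trans ?_
      gcongr
      rw [add_comm]
      exact norm_add_le _ _
    have hPL := norm_le_exp_abs_im hG (S := √T) hσ hGC (fun x => by
      refine Real.le_sqrt_of_sq_le ?_
      rw [hGn]
      exact hTx x)
    intro z
    rw [← hGn]
    calc ‖G z‖ ^ 2 ≤ (√T * Real.exp (σ * |z.im|)) ^ 2 := by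
          gcongr
          exact hPL z
      _ = _ := by
          rw [mul_pow, Real.sq_sqrt hT0, ← Real.exp_nat_mul]
          push_cast
          ring_nf
  have hcont : Continuous fun z => ‖f z‖ := hf.continuous.norm
  have hfR : Continuous fun u : ℝ => ‖f u‖ := (hf.continuous.comp Complex.continuous_ofReal).norm
  have hmain : ∀ x : ℝ, ∑ k ∈ F, ‖f ((x : ℂ) + (k * L : ℝ))‖ ^ 2 ≤
      1 / 2 * T + 2 * (K ^ n) ^ 2 * η * A := by
    intro x
    obtain ⟨y, hy, hyA⟩ := hA x
    have hterm : ∀ k ∈ F, ‖f ((x : ℂ) + (k * L : ℝ))‖ ^ 2 ≤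
        2 * (1 / 4) ^ n * Real.circleAverage (fun z => ‖f (z + (k * L : ℝ))‖ ^ 2) x (3 * L) +
        2 * (K ^ n) ^ 2 * η * ∫ u in (y k)..(y k + η), ‖f u‖ ^ 2 := by
      intro k _
      have h1 := hloc n f hf (x + k * L) (y k) (hy k).1 (hy k).2
      have h2 : Real.circleAverage (fun z => ‖f z‖) ((x + k * L : ℝ) : ℂ) (3 * L) ^ 2 ≤
          Real.circleAverage (fun z => ‖f (z + (k * L : ℝ))‖ ^ 2) x (3 * L) := by
        refine (sq_circleAverage_le hcont _ _).trans (le_of_eq ?_)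
        simp only [Real.circleAverage_def, circleMap]
        congr 2
        ext θ
        push_cast
        ring_nf
      have h3 := sq_intervalIntegral_le hfR (a := y k) (b := y k + η) (by linarith)
      rw [add_sub_cancel_left] at h3
      set a := Real.circleAverage (fun z => ‖f z‖) ((x + k * L : ℝ) : ℂ) (3 * L)
      set b := ∫ u in (y k)..(y k + η), ‖f u‖
      have e : (x : ℂ) + (k * L : ℝ) = ((x + k * L : ℝ) : ℂ) := by push_cast; ring
      rw [e]
      have e4 : ((1 : ℝ) / 4) ^ n = ((1 / 2) ^ n) ^ 2 := by
        rw [← pow_mul, mul_comm, pow_mul]; norm_num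
      calc ‖f ((x + k * L : ℝ) : ℂ)‖ ^ 2 ≤ ((1 / 2) ^ n * a + K ^ n * b) ^ 2 := by gcongr
        _ ≤ 2 * ((1 / 2) ^ n) ^ 2 * a ^ 2 + 2 * (K ^ n) ^ 2 * b ^ 2 := by
          nlinarith [sq_nonneg ((1 / 2) ^ n * a - K ^ n * b)]
        _ ≤ 2 * ((1 / 2) ^ n) ^ 2 *
              Real.circleAverage (fun z => ‖f (z + (k * L : ℝ))‖ ^ 2) x (3 * L) +
            2 * (K ^ n) ^ 2 * (η * ∫ u in (y k)..(y k + η), ‖f u‖ ^ 2) := by gcongr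
        _ = _ := by rw [e4]; ring
    have hsumavg : ∑ k ∈ F, Real.circleAverage (fun z => ‖f (z + (k * L : ℝ))‖ ^ 2) x (3 * L) ≤
        T * Real.exp (2 * σ * (3 * L)) := by
      have hc : ∀ k : ℤ, Continuous fun z => ‖f (z + (k * L : ℝ))‖ ^ 2 := fun k =>
        (hcont.comp (continuous_id.add continuous_const)).pow 2
      rw [← Real.circleAverage_fun_sum fun k _ => (hc k).continuousOn.circleIntegrable']
      refine Real.circleAverage_mono_on_of_le_circle
        (continuous_finsetSum _ fun k _ => hc k).continuousOn.circleIntegrable' fun z hz => ?_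
      rw [abs_of_pos (by positivity), mem_sphere_iff_norm] at hz
      have h2 := Complex.abs_im_le_norm (z - x)
      rw [hz] at h2
      simp only [Complex.sub_im, Complex.ofReal_im, sub_zero] at h2
      exact (hTz z).trans (by gcongr)
    calc _ ≤ _ := Finset.sum_le_sum hterm
      _ = 2 * (1 / 4) ^ n *
            ∑ k ∈ F, Real.circleAverage (fun z => ‖f (z + (k * L : ℝ))‖ ^ 2) x (3 * L) +
          2 * (K ^ n) ^ 2 * η * ∑ k ∈ F, ∫ u in (y k)..(y k + η), ‖f u‖ ^ 2 := by
          rw [Finset.sum_add_distrib, Finset.mul_sum, Finset.mul_sum]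
      _ ≤ 2 * (1 / 4) ^ n * (T * Real.exp (2 * σ * (3 * L))) + 2 * (K ^ n) ^ 2 * η * A := by
          gcongr
          exact hyA F
      _ ≤ _ := by nlinarith
  have hTle : T ≤ 1 / 2 * T + 2 * (K ^ n) ^ 2 * η * A := ciSup_le hmain
  have hTle' : T ≤ 4 * (K ^ n) ^ 2 * η * A := by linarith
  exact fun z => (hTz z).trans (by gcongr)

/-- Folding the line: the integral over `[-NL, NL]` is the integral over `[0, L]` of a sum of `2N`
translates, hence at most `L * D` for every `N`. -/
theorem integrable_and_integral_le_of_sum_translates_le {g : ℝ → ℝ} (hg : Continuous g)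
    (hg0 : ∀ x, 0 ≤ g x) {L D : ℝ} (hL : 0 < L)
    (h : ∀ (F : Finset ℤ) (x : ℝ), ∑ k ∈ F, g (x + k * L) ≤ D) :
    Integrable g ∧ ∫ x, g x ≤ L * D := by
  have hint : ∀ N : ℕ, ∫ x in (-(N * L))..(N * L), g x ≤ L * D := by
    intro N
    have e := intervalIntegral.sum_integral_adjacent_intervals (f := g) (μ := volume)
      (a := fun k : ℕ => ((k : ℝ) - N) * L) (n := 2 * N) fun k _ => hg.intervalIntegrable _ _
    have e0 : (((0 : ℕ) : ℝ) - N) * L = -(N * L) := by push_cast; ring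
    have e1 : (((2 * N : ℕ) : ℝ) - N) * L = N * L := by push_cast; ring
    rw [e0, e1] at e
    rw [← e]
    have e2 : ∀ k : ℕ, ∫ x in (((k : ℝ) - N) * L)..((((k + 1 : ℕ) : ℝ) - N) * L), g x =
        ∫ x in (0 : ℝ)..L, g (x + ((k : ℤ) - (N : ℤ) : ℤ) * L) := by
      intro k
      rw [intervalIntegral.integral_comp_add_right]
      congr 1 <;> push_cast <;> ring
    have hc : ∀ k : ℤ, Continuous fun x => g (x + k * L) := fun k =>
      hg.comp (continuous_id.add continuous_const)
    simp_rw [e2]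
    rw [← intervalIntegral.integral_finsetSum fun k _ => (hc _).intervalIntegrable _ _]
    have h3 := intervalIntegral.integral_mono_on (a := 0) (b := L) (μ := volume) hL.le
      ((continuous_finsetSum (Finset.range (2 * N)) fun k _ =>
        hc ((k : ℤ) - (N : ℤ))).intervalIntegrable _ _)
      (intervalIntegrable_const (c := D)) (fun x _ => by
        have := h ((Finset.range (2 * N)).image fun k : ℕ => (k : ℤ) - (N : ℤ)) x
        rw [Finset.sum_image (fun a _ b _ hab => by simpa using hab)] at this
        exact this)
    rwa [intervalIntegral.integral_const, sub_zero, smul_eq_mul] at h3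
  have hN : Filter.Tendsto (fun N : ℕ => (N : ℝ) * L) Filter.atTop Filter.atTop :=
    tendsto_natCast_atTop_atTop.atTop_mul_const hL
  have hNn : Filter.Tendsto (fun N : ℕ => -((N : ℝ) * L)) Filter.atTop Filter.atBot :=
    Filter.tendsto_neg_atTop_atBot.comp hN
  have hi : Integrable g := by
    refine integrable_of_intervalIntegral_norm_bounded (L * D)
      (fun N => (hg.integrableOn_Ioc)) hNn hN (Filter.Eventually.of_forall fun N => ?_)
    simp_rw [Real.norm_of_nonneg (hg0 _)]
    exact hint N
  exact ⟨hi, le_of_tendsto' (intervalIntegral_tendsto_integral hi hNn hN) hint⟩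

/-- A Logvinenko-Sereda inequality: square sums over translates are controlled by an integral against
a weight that is bounded below on a relatively dense family of intervals. -/
theorem exists_sum_norm_sq_le_integral {σ L η δ : ℝ} (hσ : 0 ≤ σ) (hη : 0 < η) (hηL : η ≤ L)
    (hδ : 0 < δ) {m : ℝ → ℝ} (hm0 : ∀ x, 0 ≤ m x)
    (hm : ∀ x, ∃ y, x ≤ y ∧ y + η ≤ x + L ∧ ∀ u ∈ Set.Icc y (y + η), δ ≤ m u) :
    ∃ B : ℝ, 0 ≤ B ∧ ∀ (f : ℂ → ℂ) (C : ℝ), Differentiable ℂ f →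
      (∀ z, ‖f z‖ ≤ C * Real.exp (σ * ‖z‖)) → Integrable (fun x : ℝ => ‖f x‖ ^ 2 * m x) →
      ∀ (F : Finset ℤ) (z : ℂ), ∑ k ∈ F, ‖f (z + (k * L : ℝ))‖ ^ 2 ≤
        B * (∫ x : ℝ, ‖f x‖ ^ 2 * m x) * Real.exp (2 * σ * |z.im|) := by
  obtain ⟨B, hB0, hB⟩ := exists_sum_norm_sq_le hσ hη hηL
  refine ⟨B * δ⁻¹, by positivity, fun f C hf hC hi => ?_⟩
  have hfR : Continuous fun u : ℝ => ‖f u‖ := (hf.continuous.comp Complex.continuous_ofReal).norm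
  have hfR2 : Continuous fun u : ℝ => ‖f u‖ ^ 2 := hfR.pow 2
  set I := ∫ x : ℝ, ‖f x‖ ^ 2 * m x with hI
  have hnn : ∀ x : ℝ, 0 ≤ ‖f x‖ ^ 2 * m x := fun x => mul_nonneg (sq_nonneg _) (hm0 x)
  have hsum : ∀ x : ℝ, ∃ y : ℤ → ℝ, (∀ k, x + k * L ≤ y k ∧ y k + η ≤ x + k * L + L) ∧
      ∀ F : Finset ℤ, ∑ k ∈ F, ∫ u in (y k)..(y k + η), ‖f u‖ ^ 2 ≤ δ⁻¹ * I := by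
    intro x
    choose y hy1 hy2 hy3 using fun k : ℤ => hm (x + k * L)
    refine ⟨y, fun k => ⟨hy1 k, hy2 k⟩, fun F => ?_⟩
    have h1 : ∀ k, ∫ u in (y k)..(y k + η), ‖f u‖ ^ 2 ≤
        δ⁻¹ * ∫ u in Set.Ioc (y k) (y k + η), ‖f u‖ ^ 2 * m u := by
      intro k
      rw [intervalIntegral.integral_of_le (by linarith), ← integral_const_mul]
      refine setIntegral_mono_on hfR2.integrableOn_Ioc (hi.integrableOn.const_mul _)
        measurableSet_Ioc fun u hu => ?_
      have h2 := hy3 k u (Set.Ioc_subset_Icc_self hu)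
      rw [inv_mul_eq_div, le_div_iff₀ hδ]
      gcongr
    have hdisj : Pairwise (Function.onFun Disjoint fun k : ℤ => Set.Ioc (y k) (y k + η)) := by
      have hlt : ∀ i j : ℤ, i < j → Disjoint (Set.Ioc (y i) (y i + η)) (Set.Ioc (y j) (y j + η)) := by
        intro i j hij
        rw [Set.disjoint_left]
        intro u hu hv
        have h3 : ((i + 1 : ℤ) : ℝ) ≤ j := by exact_mod_cast hij
        push_cast at h3
        have h4 : ((i : ℝ) + 1) * L ≤ j * L := by gcongr; linarith
        have := hy2 i
        have := hy1 j
        linarith [hu.2, hv.1]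
      intro i j hij
      rcases lt_or_gt_of_ne hij with h | h
      · exact hlt i j h
      · exact (hlt j i h).symm
    calc _ ≤ ∑ k ∈ F, δ⁻¹ * ∫ u in Set.Ioc (y k) (y k + η), ‖f u‖ ^ 2 * m u :=
          Finset.sum_le_sum fun k _ => h1 k
      _ = δ⁻¹ * ∫ u in ⋃ k ∈ F, Set.Ioc (y k) (y k + η), ‖f u‖ ^ 2 * m u := by
          rw [← Finset.mul_sum, integral_biUnion_finset F (fun _ _ => measurableSet_Ioc)
            (fun i _ j _ hij => hdisj hij) (fun _ _ => hi.integrableOn)]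
      _ ≤ _ := by
          gcongr
          exact setIntegral_le_integral hi (Filter.Eventually.of_forall hnn)
  -- The boundedness criterion asks for integrals of `|f|`; these follow from those of `|f|²` by `t
  -- ≤ 1 + t²`.
  obtain ⟨S, hS⟩ : ∃ S : ℝ, ∀ x : ℝ, ‖f x‖ ≤ S := by
    refine exists_norm_real_le hf (A := η + δ⁻¹ * I) hσ hC hη hηL fun x => ?_
    obtain ⟨y, hy, hyF⟩ := hsum x
    have h0 := hyF {0}
    rw [Finset.sum_singleton] at h0
    refine ⟨y 0, by simpa using (hy 0).1, by simpa using (hy 0).2, ?_⟩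
    have h1 : ∫ u in (y 0)..(y 0 + η), ‖f u‖ ≤ ∫ u in (y 0)..(y 0 + η), (1 + ‖f u‖ ^ 2) :=
      intervalIntegral.integral_mono_on (by linarith) (hfR.intervalIntegrable _ _)
        ((continuous_const.add hfR2).intervalIntegrable _ _)
        fun u _ => by nlinarith [sq_nonneg (‖f u‖ - 1), sq_nonneg ‖f u‖]
    rw [intervalIntegral.integral_add (continuous_const.intervalIntegrable _ _)
      (hfR2.intervalIntegrable _ _), intervalIntegral.integral_const, smul_eq_mul] at h1
    linarith
  intro F z
  have := hB f C S (δ⁻¹ * I) hf hC hS hsum F z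
  rwa [← mul_assoc] at this

/-- A function of exponential type that is square integrable against a weight bounded below on a
relatively dense family of intervals is square integrable. -/
theorem integrable_norm_sq_of_integrable_mul {σ L η δ : ℝ} (hσ : 0 ≤ σ) (hη : 0 < η) (hηL : η ≤ L)
    (hδ : 0 < δ) {m : ℝ → ℝ} (hm0 : ∀ x, 0 ≤ m x)
    (hm : ∀ x, ∃ y, x ≤ y ∧ y + η ≤ x + L ∧ ∀ u ∈ Set.Icc y (y + η), δ ≤ m u)
    {f : ℂ → ℂ} {C : ℝ} (hf : Differentiable ℂ f) (hC : ∀ z, ‖f z‖ ≤ C * Real.exp (σ * ‖z‖))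
    (hi : Integrable (fun x : ℝ => ‖f x‖ ^ 2 * m x)) : Integrable fun x : ℝ => ‖f x‖ ^ 2 := by
  obtain ⟨B, -, hB⟩ := exists_sum_norm_sq_le_integral hσ hη hηL hδ hm0 hm
  have hfR : Continuous fun u : ℝ => ‖f u‖ := (hf.continuous.comp Complex.continuous_ofReal).norm
  have hfR2 : Continuous fun u : ℝ => ‖f u‖ ^ 2 := hfR.pow 2
  refine (integrable_and_integral_le_of_sum_translates_le hfR2 (fun _ => sq_nonneg _)
    (D := B * ∫ x : ℝ, ‖f x‖ ^ 2 * m x) (hη.trans_le hηL) fun F x => ?_).1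
  have := hB f C hf hC hi F x
  simpa using this

/-! ### The Paley-Wiener space -/

theorem ExpTypeAtMost.exists_le {τ : ℝ} {f : ℂ → ℂ} (h : ExpTypeAtMost τ f) {σ : ℝ} (hσ : τ < σ) :
    ∃ C : ℝ, ∀ z, ‖f z‖ ≤ C * Real.exp (σ * ‖z‖) := by
  have := h (σ - τ) (by linarith)
  simpa using this

theorem integrable_norm_sq_of_mem_PW {τ : ℝ} {f : ℂ → ℂ} (hf : f ∈ PW τ) :
    Integrable fun x : ℝ => ‖f x‖ ^ 2 :=
  (memLp_two_iff_integrable_sq_norm hf.2.2.aestronglyMeasurable).1 hf.2.2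

theorem mem_PW_iff {τ : ℝ} {f : ℂ → ℂ} : f ∈ PW τ ↔ Differentiable ℂ f ∧ ExpTypeAtMost τ f ∧
    Integrable fun x : ℝ => ‖f x‖ ^ 2 := by
  refine ⟨fun h => ⟨h.1, h.2.1, integrable_norm_sq_of_mem_PW h⟩, fun h => ⟨h.1, h.2.1, ?_⟩⟩
  exact (memLp_two_iff_integrable_sq_norm
    (h.1.continuous.comp Complex.continuous_ofReal).aestronglyMeasurable).2 h.2.2

/-- The case of the weight `1`, a discrete Plancherel-Pólya inequality. `B` does not depend on `f`,
so it controls point values, integrals over horizontal lines and limits of Cauchy sequences. -/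
theorem exists_sum_norm_sq_le_of_mem_PW {τ σ : ℝ} (hσ : 0 ≤ σ) (hτ : τ < σ) :
    ∃ B : ℝ, 0 ≤ B ∧ ∀ f ∈ PW τ, ∀ (F : Finset ℤ) (z : ℂ),
      ∑ k ∈ F, ‖f (z + k)‖ ^ 2 ≤ B * (∫ x : ℝ, ‖f x‖ ^ 2) * Real.exp (2 * σ * |z.im|) := by
  obtain ⟨B, hB0, hB⟩ := exists_sum_norm_sq_le_integral (L := 1) (η := 1) (δ := 1) hσ one_pos le_rfl
    one_pos (m := fun _ => 1) (fun _ => zero_le_one) (fun x => ⟨x, le_rfl, le_rfl, fun _ _ => le_rfl⟩)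
  refine ⟨B, hB0, fun f hf F z => ?_⟩
  obtain ⟨C, hC⟩ := hf.2.1.exists_le hτ
  have := hB f C hf.1 hC (by simpa using integrable_norm_sq_of_mem_PW hf) F z
  simpa using this

/-- Evaluation is bounded on the Paley-Wiener space. -/
theorem exists_norm_sq_le_of_mem_PW {τ σ : ℝ} (hσ : 0 ≤ σ) (hτ : τ < σ) :
    ∃ B : ℝ, 0 ≤ B ∧ ∀ f ∈ PW τ, ∀ z : ℂ,
      ‖f z‖ ^ 2 ≤ B * (∫ x : ℝ, ‖f x‖ ^ 2) * Real.exp (2 * σ * |z.im|) := by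
  obtain ⟨B, hB0, hB⟩ := exists_sum_norm_sq_le_of_mem_PW hσ hτ
  exact ⟨B, hB0, fun f hf z => by simpa using hB f hf {0} z⟩

/-! ### The Fourier transform of the measure -/

theorem norm_exp_fourier (ξ α : ℝ) : ‖Complex.exp (-2 * Real.pi * Complex.I * ξ * α)‖ = 1 := by
  rw [Complex.norm_exp]
  simp

theorem norm_measureFourier_le (ν : Measure ℝ) (ξ : ℝ) :
    ‖measureFourier ν ξ‖ ≤ ν.real Set.univ := by
  refine (norm_integral_le_integral_norm _).trans ?_
  simp_rw [norm_exp_fourier]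
  simp

theorem integrable_exp_fourier (ν : Measure ℝ) [IsFiniteMeasure ν] (ξ : ℝ) :
    Integrable (fun α : ℝ => Complex.exp (-2 * Real.pi * Complex.I * ξ * α)) ν :=
  (integrable_const (1 : ℝ)).mono' (by fun_prop)
    (Filter.Eventually.of_forall fun α => (norm_exp_fourier ξ α).le)

theorem conj_measureFourier (ν : Measure ℝ) (ξ : ℝ) :
    conj (measureFourier ν ξ) = measureFourier ν (-ξ) := by
  rw [measureFourier, measureFourier, ← integral_conj]
  congr 1
  ext α
  rw [← Complex.exp_conj]
  simp [Complex.conj_ofNat]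

/-- Frequencies in the support are at most `Δ` in modulus. The Lipschitz bound later spreads a lower
bound at one point to an interval of fixed length. -/
theorem norm_measureFourier_sub_le {Δ : ℝ} (ν : Measure ℝ) [IsFiniteMeasure ν]
    (hν : ν (Set.Icc (-Δ) Δ)ᶜ = 0) (x y : ℝ) :
    ‖measureFourier ν x - measureFourier ν y‖ ≤
      2 * Real.pi * Δ * ν.real Set.univ * |x - y| := by
  rw [measureFourier, measureFourier,
    ← integral_sub (integrable_exp_fourier ν x) (integrable_exp_fourier ν y)]
  have h : ∀ᵐ α : ℝ ∂ν, ‖Complex.exp (-2 * Real.pi * Complex.I * x * α) -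
      Complex.exp (-2 * Real.pi * Complex.I * y * α)‖ ≤ 2 * Real.pi * Δ * |x - y| := by
    have hae : ∀ᵐ α : ℝ ∂ν, α ∈ Set.Icc (-Δ) Δ := by
      rw [ae_iff]; exact hν
    filter_upwards [hae] with α hα
    have e : Complex.exp (-2 * Real.pi * Complex.I * x * α) -
        Complex.exp (-2 * Real.pi * Complex.I * y * α) =
        Complex.exp (-2 * Real.pi * Complex.I * y * α) *
          (Complex.exp (Complex.I * (-2 * Real.pi * (x - y) * α : ℝ)) - 1) := by
      rw [mul_sub, mul_one, ← Complex.exp_add]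
      congr 2
      push_cast
      ring
    rw [e, norm_mul, norm_exp_fourier, one_mul]
    refine (Real.norm_exp_I_mul_ofReal_sub_one_le).trans ?_
    rw [Real.norm_eq_abs, abs_mul, abs_mul, abs_mul, abs_neg, abs_two, abs_of_pos Real.pi_pos]
    have h1 : |α| ≤ Δ := abs_le.2 hα
    have h2 := mul_le_mul_of_nonneg_left h1 (by positivity : 0 ≤ 2 * Real.pi * |x - y|)
    linarith
  refine (norm_integral_le_of_norm_le_const h).trans (le_of_eq ?_)
  ring

theorem continuous_measureFourier (ν : Measure ℝ) [IsFiniteMeasure ν] :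
    Continuous (measureFourier ν) := by
  refine continuous_of_dominated (bound := fun _ => 1) (fun ξ => by fun_prop)
    (fun ξ => Filter.Eventually.of_forall fun α => (norm_exp_fourier ξ α).le)
    (integrable_const _) (Filter.Eventually.of_forall fun α => by fun_prop)

theorem ExpTypeAtMost.comp_add_const {τ : ℝ} (hτ : 0 ≤ τ) {f : ℂ → ℂ} (h : ExpTypeAtMost τ f)
    (w : ℂ) : ExpTypeAtMost τ fun z => f (z + w) := by
  intro ε hε
  obtain ⟨C, hC⟩ := h ε hε
  have hC0 : 0 ≤ C := by
    have := (norm_nonneg _).trans (hC 0)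
    simpa using this
  refine ⟨C * Real.exp ((τ + ε) * ‖w‖), fun z => (hC _).trans ?_⟩
  rw [mul_assoc, ← Real.exp_add]
  refine mul_le_mul_of_nonneg_left (Real.exp_le_exp.2 ?_) hC0
  have := mul_le_mul_of_nonneg_left (norm_add_le z w) (by linarith : 0 ≤ τ + ε)
  linarith

theorem comp_add_const_mem_PW {τ : ℝ} (hτ : 0 ≤ τ) {f : ℂ → ℂ} (h : f ∈ PW τ) (t : ℝ) :
    (fun z => f (z + t)) ∈ PW τ := by
  refine mem_PW_iff.2 ⟨h.1.comp (differentiable_id.add_const _), h.2.1.comp_add_const hτ t, ?_⟩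
  have := (integrable_norm_sq_of_mem_PW h).comp_add_right t
  simpa using this

theorem eq_zero_of_mem_PW_of_integral_eq_zero {τ : ℝ} (hτ : 0 ≤ τ) {f : ℂ → ℂ} (hf : f ∈ PW τ)
    (h0 : ∫ x : ℝ, ‖f x‖ ^ 2 = 0) : f = 0 := by
  obtain ⟨B, -, hB⟩ := exists_norm_sq_le_of_mem_PW (τ := τ) (σ := τ + 1) (by linarith) (by linarith)
  ext z
  have := hB f hf z
  rw [h0, mul_zero, zero_mul] at this
  have h2 : ‖f z‖ ^ 2 = 0 := le_antisymm this (sq_nonneg _)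
  simpa using h2

/-- The witness is `(exp(iτz) - 1) / z`, with the removable singularity filled by `dslope`; it
decays like `1 / |x|` on the line and equals `iτ` at `0`. -/
theorem exists_mem_PW_apply_zero_ne_zero {τ : ℝ} (hτ : 0 < τ) : ∃ f ∈ PW τ, f 0 ≠ 0 := by
  set e : ℂ → ℂ := fun z => Complex.exp (Complex.I * τ * z) with he
  have hed : Differentiable ℂ e := by fun_prop
  have hd : Differentiable ℂ (dslope e 0) :=
    differentiableOn_univ.1 ((Complex.differentiableOn_dslope (f := e) (c := 0)
      Filter.univ_mem).2 hed.differentiableOn)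
  have he0 : e 0 = 1 := by simp [he]
  have hmul : ∀ z, ‖z‖ * ‖dslope e 0 z‖ = ‖e z - 1‖ := by
    intro z
    have := sub_smul_dslope e 0 z
    rw [sub_zero, smul_eq_mul, he0] at this
    rw [← norm_mul, this]
  obtain ⟨C, hC⟩ := (isCompact_closedBall (0 : ℂ) 1).exists_bound_of_continuousOn
    hd.continuous.continuousOn
  have hC0 : 0 ≤ C := (norm_nonneg _).trans (hC 0 (by simp))
  have hsmall : ∀ z : ℂ, ‖z‖ ≤ 1 → ‖dslope e 0 z‖ ≤ C := fun z hz => hC z (by simpa using hz)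
  have hen : ∀ z, ‖e z‖ ≤ Real.exp (τ * ‖z‖) := by
    intro z
    refine (Complex.norm_exp_le_exp_norm _).trans (le_of_eq ?_)
    simp [abs_of_pos hτ]
  refine ⟨dslope e 0, mem_PW_iff.2 ⟨hd, fun ε hε => ⟨C + 2, fun z => ?_⟩, ?_⟩, ?_⟩
  · have h1 : 1 ≤ Real.exp (τ * ‖z‖) := Real.one_le_exp (by positivity)
    have h2 : Real.exp (τ * ‖z‖) ≤ Real.exp ((τ + ε) * ‖z‖) := by gcongr; linarith
    rcases le_total ‖z‖ 1 with h | h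
    · nlinarith [hsmall z h]
    · have h3 : ‖dslope e 0 z‖ ≤ ‖e z - 1‖ := by
        rw [← hmul]
        exact le_mul_of_one_le_left (norm_nonneg _) h
      have h4 := norm_sub_le (e z) 1
      rw [norm_one] at h4
      nlinarith [hen z]
  · refine Integrable.mono' (integrable_inv_one_add_sq.const_mul (2 * C ^ 2 + 8))
      ((hd.continuous.comp Complex.continuous_ofReal).norm.pow 2).aestronglyMeasurable
      (Filter.Eventually.of_forall fun x => ?_)
    rw [Real.norm_of_nonneg (sq_nonneg _), ← div_eq_mul_inv, le_div_iff₀ (by positivity)]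
    rcases le_total |x| 1 with h | h
    · have h1 := hsmall x (by simpa using h)
      have h2 : x ^ 2 ≤ 1 := (sq_le_one_iff_abs_le_one x).2 h
      have h3 : ‖dslope e 0 x‖ ^ 2 ≤ C ^ 2 := by gcongr
      nlinarith [sq_nonneg (‖dslope e 0 (x : ℂ)‖)]
    · have h1 := hmul x
      have h2 : ‖e x - 1‖ ≤ 2 := by
        have : ‖e x‖ = 1 := by
          rw [he]; simp only; rw [Complex.norm_exp]; simp
        calc _ ≤ ‖e x‖ + ‖(1 : ℂ)‖ := norm_sub_le _ _
          _ = 2 := by rw [this, norm_one]; norm_num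
      rw [← h1, Complex.norm_real, Real.norm_eq_abs] at h2
      have h3 : x ^ 2 * ‖dslope e 0 x‖ ^ 2 ≤ 4 := by
        rw [← sq_abs x, ← mul_pow]
        calc _ ≤ (2 : ℝ) ^ 2 := by gcongr
          _ = 4 := by norm_num
      have h4 : 1 ≤ x ^ 2 := (one_le_sq_iff_one_le_abs x).2 h
      nlinarith [sq_nonneg (‖dslope e 0 (x : ℂ)‖), sq_nonneg C]
  · rw [dslope_same]
    have : HasDerivAt e (Complex.exp (Complex.I * τ * 0) * (Complex.I * τ * 1)) 0 :=
      ((hasDerivAt_id (0 : ℂ)).const_mul _).cexp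
    rw [this.deriv]
    simp [hτ.ne']

theorem integrable_mul_measureFourier (ν : Measure ℝ) [IsFiniteMeasure ν] {g : ℝ → ℂ}
    (hg : Integrable g) : Integrable fun x => g x * measureFourier ν x :=
  hg.mul_bdd (c := ν.real Set.univ) (continuous_measureFourier ν).aestronglyMeasurable
    (Filter.Eventually.of_forall fun x => norm_measureFourier_le ν x)

theorem norm_nuNormSq_le (ν : Measure ℝ) (f : ℂ → ℂ) :
    ‖nuNormSq ν f‖ ≤ ∫ x : ℝ, ‖f x‖ ^ 2 * ‖measureFourier ν x‖ := by
  refine (norm_integral_le_integral_norm _).trans (le_of_eq ?_)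
  congr 1
  ext x
  rw [norm_mul, Complex.norm_real, Real.norm_of_nonneg (sq_nonneg _)]

/-- If the real part of `nuNormSq` is negative, the real square root makes `nuNorm` zero, and the
hypothesis forces the left side to vanish. -/
theorem sq_mul_integral_le_norm_nuNormSq {ν : Measure ℝ} {f : ℂ → ℂ} {a : ℝ} (ha : 0 < a)
    (h : a * l2Norm f ≤ nuNorm ν f) : a ^ 2 * ∫ x : ℝ, ‖f x‖ ^ 2 ≤ ‖nuNormSq ν f‖ := by
  have h0 : 0 ≤ ∫ x : ℝ, ‖f x‖ ^ 2 := integral_nonneg fun _ => sq_nonneg _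
  have h1 : (a * l2Norm f) ^ 2 ≤ nuNorm ν f ^ 2 := by
    have : 0 ≤ l2Norm f := Real.sqrt_nonneg _
    gcongr
  rw [mul_pow, l2Norm, Real.sq_sqrt h0, nuNorm] at h1
  rcases le_total 0 (nuNormSq ν f).re with h2 | h2
  · rw [Real.sq_sqrt h2] at h1
    exact h1.trans ((le_abs_self _).trans (Complex.abs_re_le_norm _))
  · rw [Real.sqrt_eq_zero_of_nonpos h2] at h1
    exact h1.trans (by simp)

/-- The norm inequality forces the Fourier transform of the measure to be bounded below on a
relatively dense family of intervals. -/
theorem exists_le_norm_measureFourier {Δ : ℝ} (hΔ : 0 < Δ) (ν : Measure ℝ) [IsFiniteMeasure ν]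
    (hν : ν (Set.Icc (-Δ) Δ)ᶜ = 0) {a : ℝ} (ha : 0 < a)
    (hnorm : ∀ f ∈ PW (Real.pi * Δ), a * l2Norm f ≤ nuNorm ν f) :
    ∃ L η δ : ℝ, 0 < η ∧ η ≤ L ∧ 0 < δ ∧ ∀ x, ∃ y, x ≤ y ∧ y + η ≤ x + L ∧
      ∀ u ∈ Set.Icc y (y + η), δ ≤ ‖measureFourier ν u‖ := by
  have hτ : 0 < Real.pi * Δ := by positivity
  obtain ⟨φ, hφ, hφ0⟩ := exists_mem_PW_apply_zero_ne_zero hτ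
  set Q := ∫ x : ℝ, ‖φ x‖ ^ 2 with hQ
  have hQ0 : 0 < Q := by
    refine lt_of_le_of_ne (integral_nonneg fun _ => sq_nonneg _) fun h => hφ0 ?_
    rw [eq_zero_of_mem_PW_of_integral_eq_zero hτ.le hφ h.symm]
    rfl
  have hφi := integrable_norm_sq_of_mem_PW hφ
  set V := ν.real Set.univ with hV
  have hV0 : 0 ≤ V := measureReal_nonneg
  obtain ⟨T, hT0, hT⟩ : ∃ T : ℝ, 0 ≤ T ∧ V * (Q - ∫ x in (-T)..T, ‖φ x‖ ^ 2) < a ^ 2 / 4 * Q := by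
    have h := intervalIntegral_tendsto_integral hφi Filter.tendsto_neg_atTop_atBot Filter.tendsto_id
    have h2 := (h.const_sub Q).const_mul V
    rw [← hQ, sub_self, mul_zero] at h2
    exact ((Filter.eventually_ge_atTop 0).and
      (h2.eventually (gt_mem_nhds (by positivity : 0 < a ^ 2 / 4 * Q)))).exists
  -- Were `|ν̂| < a² / 2` on a whole window, the translate of `φ` to it would have `|‖·‖_ν²|` at
  -- most `(a² / 2) Q` from the window plus less than `(a² / 4) Q` from the tail, against the lower
  -- bound `a² Q`.
  have hpt : ∀ t : ℝ, ∃ u ∈ Set.Ioc (-T) T, a ^ 2 / 2 ≤ ‖measureFourier ν (u + t)‖ := by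
    intro t
    by_contra! hcon
    have h1 := sq_mul_integral_le_norm_nuNormSq ha
      (hnorm _ (comp_add_const_mem_PW hτ.le hφ ((-t : ℝ))))
    have h2 := h1.trans (norm_nuNormSq_le ν _)
    have e1 : ∫ x : ℝ, ‖φ (x + ((-t : ℝ) : ℂ))‖ ^ 2 = Q := by
      rw [hQ, ← integral_add_right_eq_self (fun x : ℝ => ‖φ x‖ ^ 2) (-t)]
      simp
    have e2 : ∫ x : ℝ, ‖φ (x + ((-t : ℝ) : ℂ))‖ ^ 2 * ‖measureFourier ν x‖ =
        ∫ x : ℝ, ‖φ x‖ ^ 2 * ‖measureFourier ν (x + t)‖ := by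
      rw [← integral_add_right_eq_self (fun x : ℝ => ‖φ (x + ((-t : ℝ) : ℂ))‖ ^ 2 *
        ‖measureFourier ν x‖) t]
      congr 1
      ext x
      simp
    rw [e1, e2] at h2
    have hi2 : Integrable fun x : ℝ =>
        V * (‖φ x‖ ^ 2 - (Set.Ioc (-T) T).indicator (fun x : ℝ => ‖φ x‖ ^ 2) x) :=
      (hφi.sub (hφi.indicator measurableSet_Ioc)).const_mul _
    have h3 : ∫ x : ℝ, ‖φ x‖ ^ 2 * ‖measureFourier ν (x + t)‖ ≤
        ∫ x : ℝ, (a ^ 2 / 2 * ‖φ x‖ ^ 2 +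
          V * (‖φ x‖ ^ 2 - (Set.Ioc (-T) T).indicator (fun x : ℝ => ‖φ x‖ ^ 2) x)) := by
      refine integral_mono_of_nonneg (Filter.Eventually.of_forall fun x => by positivity)
        ((hφi.const_mul _).add hi2)
        (Filter.Eventually.of_forall fun x => ?_)
      by_cases hx : x ∈ Set.Ioc (-T) T
      · simp only [Set.indicator_of_mem hx, sub_self, mul_zero, add_zero]
        rw [mul_comm]
        exact mul_le_mul_of_nonneg_right (hcon x hx).le (sq_nonneg _)
      · simp only [Set.indicator_of_notMem hx, sub_zero]
        have := mul_le_mul_of_nonneg_left (norm_measureFourier_le ν (x + t))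
          (sq_nonneg ‖φ (x : ℂ)‖)
        have h5 : 0 ≤ a ^ 2 / 2 * ‖φ (x : ℂ)‖ ^ 2 := by positivity
        rw [← hV] at this
        linarith
    rw [integral_add (hφi.const_mul _) hi2,
      integral_const_mul, integral_const_mul, integral_sub hφi (hφi.indicator measurableSet_Ioc),
      integral_indicator measurableSet_Ioc, ← intervalIntegral.integral_of_le (by linarith),
      ← hQ] at h3
    nlinarith
  set Λ := 2 * Real.pi * Δ * V with hΛ
  have hΛ0 : 0 ≤ Λ := by positivity
  -- Over a distance `η` the Lipschitz bound costs at most `a² / 4` of the `a² / 2` available; the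
  -- `+ 1` covers `Λ = 0`.
  set η := a ^ 2 / 4 / (Λ + 1) with hη
  have hη0 : 0 < η := by positivity
  have hΛη : Λ * η ≤ a ^ 2 / 4 := by
    rw [hη, ← mul_div_assoc, div_le_iff₀ (by positivity)]
    nlinarith [sq_nonneg a]
  refine ⟨2 * T + η, η, a ^ 2 / 4, hη0, by linarith, by positivity, fun x => ?_⟩
  obtain ⟨u, hu, hua⟩ := hpt (x + T)
  refine ⟨u + (x + T), by linarith [hu.1], by linarith [hu.2], fun v hv => ?_⟩
  have h1 := norm_measureFourier_sub_le ν hν (u + (x + T)) v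
  have h2 := norm_sub_norm_le (measureFourier ν (u + (x + T))) (measureFourier ν v)
  have h3 : |u + (x + T) - v| ≤ η := by
    rw [abs_le]; constructor <;> linarith [hv.1, hv.2]
  have h4 : Λ * |u + (x + T) - v| ≤ Λ * η := by gcongr
  linarith

theorem nuSpace_eq_PW {Δ : ℝ} (hΔ : 0 < Δ) (ν : Measure ℝ) [IsFiniteMeasure ν]
    (hν : ν (Set.Icc (-Δ) Δ)ᶜ = 0) {a : ℝ} (ha : 0 < a)
    (hnorm : ∀ f ∈ PW (Real.pi * Δ), a * l2Norm f ≤ nuNorm ν f) :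
    nuSpace Δ ν = PW (Real.pi * Δ) := by
  obtain ⟨L, η, δ, hη, hηL, hδ, hm⟩ := exists_le_norm_measureFourier hΔ ν hν ha hnorm
  have hτ : 0 < Real.pi * Δ := by positivity
  ext f
  rw [mem_PW_iff]
  refine ⟨fun h => ⟨h.1, h.2.1, ?_⟩, fun h => ⟨h.1, h.2.1, ?_⟩⟩
  · obtain ⟨C, hC⟩ := h.2.1.exists_le (σ := Real.pi * Δ + 1) (by linarith)
    refine integrable_norm_sq_of_integrable_mul (σ := Real.pi * Δ + 1) (by linarith) hη hηL hδ
      (fun x => norm_nonneg _) hm h.1 hC ?_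
    refine h.2.2.norm.congr (Filter.Eventually.of_forall fun x => ?_)
    simp only
    rw [norm_mul, Complex.norm_real, Real.norm_of_nonneg (sq_nonneg _)]
  · exact integrable_mul_measureFourier ν h.2.2.ofReal

/-! ### The Hilbert space defined by the measure -/

theorem ExpTypeAtMost.add {τ : ℝ} {f g : ℂ → ℂ} (hf : ExpTypeAtMost τ f)
    (hg : ExpTypeAtMost τ g) : ExpTypeAtMost τ (f + g) := by
  intro ε hε
  obtain ⟨C, hC⟩ := hf ε hε
  obtain ⟨D, hD⟩ := hg ε hε
  refine ⟨C + D, fun z => (norm_add_le _ _).trans ?_⟩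
  rw [add_mul]
  exact add_le_add (hC z) (hD z)

theorem ExpTypeAtMost.const_smul {τ : ℝ} {f : ℂ → ℂ} (hf : ExpTypeAtMost τ f) (c : ℂ) :
    ExpTypeAtMost τ (c • f) := by
  intro ε hε
  obtain ⟨C, hC⟩ := hf ε hε
  refine ⟨‖c‖ * C, fun z => ?_⟩
  rw [Pi.smul_apply, norm_smul, mul_assoc]
  gcongr
  exact hC z

/-- The Paley-Wiener space as a space of functions. -/
def PWSubmodule (τ : ℝ) : Submodule ℂ (ℂ → ℂ) where
  carrier := PW τ
  add_mem' := fun {f g} hf hg => ⟨hf.1.add hg.1, hf.2.1.add hg.2.1, hf.2.2.add hg.2.2⟩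
  zero_mem' := ⟨differentiable_const 0, fun ε _ => ⟨0, fun z => by simp⟩, MemLp.zero⟩
  smul_mem' := fun c f hf => ⟨hf.1.const_smul c, hf.2.1.const_smul c, hf.2.2.const_smul c⟩

theorem integrable_mul_conj_of_mem_PW {τ : ℝ} {f g : ℂ → ℂ} (hf : f ∈ PW τ) (hg : g ∈ PW τ) :
    Integrable fun x : ℝ => f x * conj (g x) := by
  refine Integrable.mono' ((integrable_norm_sq_of_mem_PW hf).add (integrable_norm_sq_of_mem_PW hg))
    ((hf.1.continuous.comp Complex.continuous_ofReal).mul (Complex.continuous_conj.comp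
      (hg.1.continuous.comp Complex.continuous_ofReal))).aestronglyMeasurable
    (Filter.Eventually.of_forall fun x => ?_)
  simp only [Pi.add_apply, norm_mul, RCLike.norm_conj]
  nlinarith [sq_nonneg (‖f x‖ - ‖g x‖), sq_nonneg ‖f x‖, sq_nonneg ‖g x‖]

theorem nuForm_add_left {τ : ℝ} (ν : Measure ℝ) [IsFiniteMeasure ν] {f g h : ℂ → ℂ}
    (hf : f ∈ PW τ) (hg : g ∈ PW τ) (hh : h ∈ PW τ) :
    nuForm ν (f + g) h = nuForm ν f h + nuForm ν g h := by
  simp only [nuForm]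
  rw [← integral_add (integrable_mul_measureFourier ν (integrable_mul_conj_of_mem_PW hf hh))
    (integrable_mul_measureFourier ν (integrable_mul_conj_of_mem_PW hg hh))]
  congr 1
  ext x
  simp only [Pi.add_apply]
  ring

theorem nuForm_add_right {τ : ℝ} (ν : Measure ℝ) [IsFiniteMeasure ν] {f g h : ℂ → ℂ}
    (hf : f ∈ PW τ) (hg : g ∈ PW τ) (hh : h ∈ PW τ) :
    nuForm ν f (g + h) = nuForm ν f g + nuForm ν f h := by
  simp only [nuForm]
  rw [← integral_add (integrable_mul_measureFourier ν (integrable_mul_conj_of_mem_PW hf hg))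
    (integrable_mul_measureFourier ν (integrable_mul_conj_of_mem_PW hf hh))]
  congr 1
  ext x
  simp only [Pi.add_apply, map_add]
  ring

theorem nuForm_smul_left (ν : Measure ℝ) (c : ℂ) (f g : ℂ → ℂ) :
    nuForm ν (c • f) g = c * nuForm ν f g := by
  simp only [nuForm]
  rw [← integral_const_mul]
  congr 1
  ext x
  simp only [Pi.smul_apply, smul_eq_mul]
  ring

theorem nuForm_smul_right (ν : Measure ℝ) (c : ℂ) (f g : ℂ → ℂ) :
    nuForm ν f (c • g) = conj c * nuForm ν f g := by
  simp only [nuForm]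
  rw [← integral_const_mul]
  congr 1
  ext x
  simp only [Pi.smul_apply, smul_eq_mul, map_mul]
  ring

theorem nuForm_self (ν : Measure ℝ) (f : ℂ → ℂ) : nuForm ν f f = nuNormSq ν f := by
  simp only [nuForm, nuNormSq]
  congr 1
  ext x
  rw [Complex.mul_conj, Complex.normSq_eq_norm_sq]

/-- A finite measure for which the associated form is equivalent to the `L²` norm on the
Paley-Wiener space. -/
structure EquivalentNorm where
  Δ : ℝ
  Δ_pos : 0 < Δ
  ν : Measure ℝ
  isFinite : IsFiniteMeasure ν
  a : ℝ
  b : ℝ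
  a_pos : 0 < a
  b_pos : 0 < b
  equiv : ∀ f ∈ PW (Real.pi * Δ), (nuNormSq ν f).im = 0 ∧
    a * l2Norm f ≤ nuNorm ν f ∧ nuNorm ν f ≤ b * l2Norm f

namespace EquivalentNorm

variable (d : EquivalentNorm)

instance : IsFiniteMeasure d.ν := d.isFinite

theorem pi_mul_pos : 0 < Real.pi * d.Δ := mul_pos Real.pi_pos d.Δ_pos

/-- Polarization: `ν̂` is not assumed real, but the quadratic form is, and its values at `f + g` and
`f + I • g` give the two components of Hermitian symmetry. -/
theorem nuForm_conj {f g : ℂ → ℂ} (hf : f ∈ PW (Real.pi * d.Δ)) (hg : g ∈ PW (Real.pi * d.Δ)) :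
    conj (nuForm d.ν f g) = nuForm d.ν g f := by
  have hI : Complex.I • g ∈ PW (Real.pi * d.Δ) := (PWSubmodule _).smul_mem _ hg
  have h1 := (d.equiv _ ((PWSubmodule _).add_mem hf hg)).1
  have h2 := (d.equiv _ ((PWSubmodule _).add_mem hf hI)).1
  have h3 := (d.equiv _ hf).1
  have h4 := (d.equiv _ hg).1
  have hfg := (PWSubmodule _).add_mem hf hg
  have hfI := (PWSubmodule _).add_mem hf hI
  rw [← nuForm_self] at h1 h2 h3 h4
  rw [nuForm_add_left _ hf hg hfg, nuForm_add_right _ hf hf hg, nuForm_add_right _ hg hf hg] at h1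
  rw [nuForm_add_left _ hf hI hfI, nuForm_add_right _ hf hf hI, nuForm_add_right _ hI hf hI,
    nuForm_smul_left, nuForm_smul_left, nuForm_smul_right, nuForm_smul_right] at h2
  simp at h1 h2
  apply Complex.ext
  · simp; linarith
  · simp; linarith

/-- A negative value would make `nuNorm` zero, so the lower bound would force `f = 0`, where the
form vanishes. -/
theorem re_nuNormSq_nonneg {f : ℂ → ℂ} (hf : f ∈ PW (Real.pi * d.Δ)) :
    0 ≤ (nuNormSq d.ν f).re := by
  by_contra! h
  have h1 := (d.equiv f hf).2.1
  rw [nuNorm, Real.sqrt_eq_zero_of_nonpos h.le] at h1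
  have h2 : l2Norm f = 0 :=
    le_antisymm (nonpos_of_mul_nonpos_right h1 d.a_pos) (Real.sqrt_nonneg _)
  rw [l2Norm, Real.sqrt_eq_zero (integral_nonneg fun _ => sq_nonneg _)] at h2
  have h3 := eq_zero_of_mem_PW_of_integral_eq_zero d.pi_mul_pos.le hf h2
  subst h3
  simp [nuNormSq] at h

theorem sq_mul_integral_le {f : ℂ → ℂ} (hf : f ∈ PW (Real.pi * d.Δ)) :
    d.a ^ 2 * ∫ x : ℝ, ‖f x‖ ^ 2 ≤ (nuNormSq d.ν f).re := by
  refine (sq_mul_integral_le_norm_nuNormSq d.a_pos (d.equiv f hf).2.1).trans (le_of_eq ?_)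
  have e : nuNormSq d.ν f = ((nuNormSq d.ν f).re : ℂ) :=
    Complex.ext rfl (by simpa using (d.equiv f hf).1)
  nth_rw 1 [e]
  rw [Complex.norm_real, Real.norm_of_nonneg (d.re_nuNormSq_nonneg hf)]

/-- The Paley-Wiener space, to be equipped with the inner product defined by the measure. -/
def Space : Type := PWSubmodule (Real.pi * d.Δ)

noncomputable instance : AddCommGroup d.Space := inferInstanceAs (AddCommGroup (PWSubmodule (Real.pi * d.Δ)))

noncomputable instance : Module ℂ d.Space := inferInstanceAs (Module ℂ (PWSubmodule (Real.pi * d.Δ)))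

/-- The inclusion of the Paley-Wiener space into the space of all functions. -/
noncomputable def incl : d.Space →ₗ[ℂ] (ℂ → ℂ) := (PWSubmodule (Real.pi * d.Δ)).subtype

theorem incl_injective : Function.Injective d.incl := Subtype.val_injective

theorem incl_mem (f : d.Space) : d.incl f ∈ PW (Real.pi * d.Δ) := Subtype.property f

theorem exists_incl_eq {f : ℂ → ℂ} (hf : f ∈ PW (Real.pi * d.Δ)) : ∃ g : d.Space, d.incl g = f :=
  ⟨⟨f, hf⟩, rfl⟩

-- The arguments are exchanged because `inner` is conjugate-linear in its first slot and `nuForm` in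
-- its second. Definiteness is the lower norm bound.
@[reducible] noncomputable def core : InnerProductSpace.Core ℂ d.Space where
  inner g f := nuForm d.ν (d.incl f) (d.incl g)
  conj_inner_symm f g := d.nuForm_conj (d.incl_mem f) (d.incl_mem g)
  re_inner_nonneg f := by
    rw [nuForm_self]
    exact d.re_nuNormSq_nonneg (d.incl_mem f)
  add_left f g h := by
    rw [map_add]
    exact nuForm_add_right _ (d.incl_mem h) (d.incl_mem f) (d.incl_mem g)
  smul_left f g c := by
    rw [map_smul]
    exact nuForm_smul_right _ _ _ _
  definite f hf := by
    rw [nuForm_self] at hf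
    have h1 := d.sq_mul_integral_le (d.incl_mem f)
    rw [hf, Complex.zero_re] at h1
    have h2 : ∫ x : ℝ, ‖d.incl f x‖ ^ 2 = 0 := le_antisymm
      (nonpos_of_mul_nonpos_right h1 (pow_pos d.a_pos 2)) (integral_nonneg fun _ => sq_nonneg _)
    have h3 := eq_zero_of_mem_PW_of_integral_eq_zero d.pi_mul_pos.le (d.incl_mem f) h2
    exact d.incl_injective (h3.trans (map_zero d.incl).symm)

noncomputable instance : NormedAddCommGroup d.Space :=
  @InnerProductSpace.Core.toNormedAddCommGroup ℂ d.Space _ _ _ d.core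

noncomputable instance : InnerProductSpace ℂ d.Space :=
  InnerProductSpace.ofCore d.core.toCore

theorem inner_eq (f g : d.Space) : inner ℂ g f = nuForm d.ν (d.incl f) (d.incl g) := rfl

theorem norm_eq (f : d.Space) : ‖f‖ = nuNorm d.ν (d.incl f) := by
  rw [norm_eq_sqrt_re_inner (𝕜 := ℂ), inner_eq, nuForm_self]
  rfl

theorem norm_sq_eq (f : d.Space) : ‖f‖ ^ 2 = (nuNormSq d.ν (d.incl f)).re := by
  rw [norm_eq, nuNorm, Real.sq_sqrt (d.re_nuNormSq_nonneg (d.incl_mem f))]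

theorem exists_sum_norm_sq_le {σ : ℝ} (hσ : Real.pi * d.Δ < σ) : ∃ B : ℝ, 0 ≤ B ∧
    ∀ (f : d.Space) (F : Finset ℤ) (z : ℂ),
      ∑ k ∈ F, ‖d.incl f (z + k)‖ ^ 2 ≤ B * ‖f‖ ^ 2 * Real.exp (2 * σ * |z.im|) := by
  obtain ⟨B, hB0, hB⟩ := exists_sum_norm_sq_le_of_mem_PW (d.pi_mul_pos.le.trans hσ.le) hσ
  have ha := d.a_pos
  refine ⟨B / d.a ^ 2, by positivity, fun f F z => (hB _ (d.incl_mem f) F z).trans ?_⟩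
  have h1 := d.sq_mul_integral_le (d.incl_mem f)
  rw [← norm_sq_eq] at h1
  rw [div_mul_eq_mul_div, mul_div_assoc]
  gcongr
  rw [le_div_iff₀ (by positivity), mul_comm]
  exact h1

theorem norm_le (f : d.Space) : ‖f‖ ≤ d.b * l2Norm (d.incl f) := by
  rw [norm_eq]
  exact (d.equiv _ (d.incl_mem f)).2.2

theorem continuous_incl : Continuous d.incl := by
  obtain ⟨B, hB0, hB⟩ := d.exists_sum_norm_sq_le (σ := Real.pi * d.Δ + 1) (by linarith)
  refine continuous_pi fun z => ?_
  refine AddMonoidHomClass.continuous_of_bound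
    ((LinearMap.proj z : (ℂ → ℂ) →ₗ[ℂ] ℂ) ∘ₗ d.incl)
    (√(B * Real.exp (2 * (Real.pi * d.Δ + 1) * |z.im|))) fun f => ?_
  rw [← abs_of_nonneg (norm_nonneg _)]
  refine abs_le_of_sq_le_sq ?_ (by positivity)
  rw [mul_pow, Real.sq_sqrt (by positivity)]
  have := hB f {0} z
  simp only [Finset.sum_singleton, Int.cast_zero, add_zero] at this
  simp only [LinearMap.coe_comp, LinearMap.coe_proj, Function.comp_apply, Function.eval]
  linarith

/-- The square-sum bound makes a Cauchy sequence converge uniformly on horizontal strips to an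
entire `G`. Passing to the limit in it and folding the line gives convergence in `L²`, which the
upper bound `b` turns into convergence in the new norm. -/
instance : CompleteSpace d.Space := by
  refine Metric.complete_of_cauchySeq_tendsto fun u hu => ?_
  have hcz : ∀ z, CauchySeq fun n => d.incl (u n) z := by
    intro z
    refine (uniformContinuous_of_continuousAt_zero
      ((LinearMap.proj z : (ℂ → ℂ) →ₗ[ℂ] ℂ) ∘ₗ d.incl).toAddMonoidHom
      (((continuous_apply z).comp d.continuous_incl).continuousAt)).comp_cauchySeq hu
  choose G hG using fun z => cauchySeq_tendsto_of_complete (hcz z)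
  -- `σ` stays free above `πΔ` so that the limit has type at most `πΔ`, not merely some larger type.
  have key : ∀ σ, Real.pi * d.Δ < σ → ∃ B : ℝ, 0 ≤ B ∧ ∀ ε : ℝ, 0 < ε → ∃ N, ∀ n ≥ N,
      ∀ (F : Finset ℤ) (z : ℂ), ∑ k ∈ F, ‖d.incl (u n) (z + k) - G (z + k)‖ ^ 2 ≤
        B * ε ^ 2 * Real.exp (2 * σ * |z.im|) := by
    intro σ hσ
    obtain ⟨B, hB0, hB⟩ := d.exists_sum_norm_sq_le hσ
    refine ⟨B, hB0, fun ε hε => ?_⟩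
    obtain ⟨N, hN⟩ := Metric.cauchySeq_iff.1 hu ε hε
    refine ⟨N, fun n hn F z => ?_⟩
    have hlim : Filter.Tendsto
        (fun m => ∑ k ∈ F, ‖d.incl (u n) (z + k) - d.incl (u m) (z + k)‖ ^ 2) Filter.atTop
        (nhds (∑ k ∈ F, ‖d.incl (u n) (z + k) - G (z + k)‖ ^ 2)) :=
      tendsto_finsetSum _ fun k _ => (((hG (z + k)).const_sub _).norm).pow 2
    refine le_of_tendsto hlim ?_
    filter_upwards [Filter.eventually_ge_atTop N] with m hm
    have h1 := hB (u n - u m) F z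
    have h2 : ‖u n - u m‖ < ε := by
      rw [← dist_eq_norm]; exact hN n hn m hm
    simp only [map_sub, Pi.sub_apply] at h1
    refine h1.trans ?_
    gcongr
  have keypt : ∀ σ, Real.pi * d.Δ < σ → ∀ ε : ℝ, 0 < ε → ∃ N, ∀ n ≥ N, ∀ z : ℂ,
      ‖d.incl (u n) z - G z‖ ≤ ε * Real.exp (σ * |z.im|) := by
    intro σ hσ ε hε
    obtain ⟨B, hB0, hB⟩ := key σ hσ
    obtain ⟨N, hN⟩ := hB (ε / √(B + 1)) (by positivity)
    refine ⟨N, fun n hn z => ?_⟩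
    have h1 := hN n hn {0} z
    simp only [Finset.sum_singleton, Int.cast_zero, add_zero] at h1
    refine le_of_sq_le_sq ?_ (by positivity)
    refine h1.trans ?_
    rw [div_pow, Real.sq_sqrt (by linarith), mul_pow, ← Real.exp_nat_mul]
    have h2 : B * (ε ^ 2 / (B + 1)) ≤ ε ^ 2 := by
      rw [← mul_div_assoc, div_le_iff₀ (by linarith)]
      nlinarith [sq_nonneg ε]
    have e : 2 * σ * |z.im| = ((2 : ℕ) : ℝ) * (σ * |z.im|) := by push_cast; ring
    rw [e]
    gcongr
  have hGd : Differentiable ℂ G := by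
    rw [← differentiableOn_univ]
    refine TendstoLocallyUniformlyOn.differentiableOn (φ := Filter.atTop)
      (F := fun n => d.incl (u n)) ?_
      (Filter.Eventually.of_forall fun n => (d.incl_mem (u n)).1.differentiableOn) isOpen_univ
    rw [tendstoLocallyUniformlyOn_univ, Metric.tendstoLocallyUniformly_iff]
    intro ε hε z
    set σ := Real.pi * d.Δ + 1 with hσ
    have hσ0 : 0 < σ := by have := d.pi_mul_pos; linarith
    obtain ⟨N, hN⟩ := keypt σ (by linarith) (ε / 2 * Real.exp (-(σ * (|z.im| + 1)))) (by positivity)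
    refine ⟨Metric.ball z 1, Metric.ball_mem_nhds z one_pos, ?_⟩
    filter_upwards [Filter.eventually_ge_atTop N] with n hn w hw
    rw [dist_comm, dist_eq_norm]
    refine (hN n hn w).trans_lt ?_
    have h1 : |w.im| ≤ |z.im| + 1 := by
      have h2 := (Complex.abs_im_le_norm (w - z)).trans (mem_ball_iff_norm.1 hw).le
      have h3 := abs_add_le (w.im - z.im) z.im
      rw [sub_add_cancel] at h3
      rw [Complex.sub_im] at h2
      linarith
    rw [mul_assoc, ← Real.exp_add]
    have h4 : Real.exp (-(σ * (|z.im| + 1)) + σ * |w.im|) ≤ 1 := by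
      rw [Real.exp_le_one_iff]
      nlinarith
    nlinarith
  have hGe : ExpTypeAtMost (Real.pi * d.Δ) G := by
    intro ε hε
    have hσ0 : 0 < Real.pi * d.Δ + ε := by have := d.pi_mul_pos; linarith
    obtain ⟨N, hN⟩ := keypt (Real.pi * d.Δ + ε) (by linarith) 1 one_pos
    obtain ⟨C, hC⟩ := (d.incl_mem (u N)).2.1 ε hε
    refine ⟨C + 1, fun z => ?_⟩
    have h1 := hN N le_rfl z
    have h2 := norm_sub_norm_le (G z) (d.incl (u N) z)
    rw [norm_sub_rev] at h2
    have h3 : Real.exp ((Real.pi * d.Δ + ε) * |z.im|) ≤ Real.exp ((Real.pi * d.Δ + ε) * ‖z‖) := by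
      gcongr
      exact Complex.abs_im_le_norm z
    nlinarith [hC z]
  obtain ⟨B, hB0, hB⟩ := key (Real.pi * d.Δ + 1) (by linarith)
  have hL2 : ∀ ε : ℝ, 0 < ε → ∃ N, ∀ n ≥ N,
      Integrable (fun x : ℝ => ‖d.incl (u n) x - G x‖ ^ 2) ∧
        ∫ x : ℝ, ‖d.incl (u n) x - G x‖ ^ 2 ≤ B * ε ^ 2 := by
    intro ε hε
    obtain ⟨N, hN⟩ := hB ε hε
    refine ⟨N, fun n hn => ?_⟩
    have := integrable_and_integral_le_of_sum_translates_le (L := 1) (D := B * ε ^ 2)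
      (g := fun x : ℝ => ‖d.incl (u n) x - G x‖ ^ 2)
      ((((d.incl_mem (u n)).1.continuous.sub hGd.continuous).comp
        Complex.continuous_ofReal).norm.pow 2) (fun _ => sq_nonneg _) one_pos
      (fun F x => by simpa using hN n hn F x)
    simpa using this
  have hGPW : G ∈ PW (Real.pi * d.Δ) := by
    obtain ⟨N, hN⟩ := hL2 1 one_pos
    refine ⟨hGd, hGe, ?_⟩
    have h1 : MemLp (fun x : ℝ => d.incl (u N) x - G x) 2 :=
      (memLp_two_iff_integrable_sq_norm (((d.incl_mem (u N)).1.continuous.sub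
        hGd.continuous).comp Complex.continuous_ofReal).aestronglyMeasurable).2 (hN N le_rfl).1
    have h2 := (d.incl_mem (u N)).2.2.sub h1
    refine h2.ae_eq (Filter.Eventually.of_forall fun x => ?_)
    simp
  obtain ⟨g, hg⟩ := d.exists_incl_eq hGPW
  refine ⟨g, Metric.tendsto_atTop.2 fun ε hε => ?_⟩
  have hb := d.b_pos
  obtain ⟨N, hN⟩ := hL2 (ε / (d.b * √(B + 1))) (by positivity)
  refine ⟨N, fun n hn => ?_⟩
  rw [dist_eq_norm]
  refine (d.norm_le _).trans_lt ?_
  rw [← lt_div_iff₀' hb, l2Norm]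
  refine (Real.sqrt_lt' (by positivity)).2 ?_
  simp only [map_sub, Pi.sub_apply, hg]
  refine (hN n hn).2.trans_lt ?_
  rw [div_pow, div_pow, mul_pow, Real.sq_sqrt (by linarith), ← mul_div_assoc,
    div_lt_div_iff₀ (by positivity) (by positivity)]
  have : 0 < ε ^ 2 * d.b ^ 2 := by positivity
  nlinarith

noncomputable instance : RKHS ℂ d.Space ℂ ℂ where
  coeCLM := ⟨d.incl, d.continuous_incl⟩
  coeCLM_injective := d.incl_injective

theorem coe_eq (f : d.Space) : (f : ℂ → ℂ) = d.incl f := rfl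

end EquivalentNorm

/-! ### The spectrum of a squared modulus -/

theorem ExpTypeAtMost.comp_neg {τ : ℝ} {f : ℂ → ℂ} (h : ExpTypeAtMost τ f) :
    ExpTypeAtMost τ fun z => f (-z) := by
  intro ε hε
  obtain ⟨C, hC⟩ := h ε hε
  exact ⟨C, fun z => by simpa using hC (-z)⟩

theorem comp_neg_mem_PW {τ : ℝ} {f : ℂ → ℂ} (h : f ∈ PW τ) : (fun z => f (-z)) ∈ PW τ := by
  refine mem_PW_iff.2 ⟨h.1.comp differentiable_neg, h.2.1.comp_neg, ?_⟩
  simpa using (integrable_norm_sq_of_mem_PW h).comp_neg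

/-- Shifting the line of integration for an entire function. -/
theorem integral_eq_integral_add_mul_I {h : ℂ → ℂ} (hd : Differentiable ℂ h) {y M : ℝ}
    (h0 : Integrable fun x : ℝ => h x) (hy : Integrable fun x : ℝ => h (x + y * Complex.I))
    (hM : ∀ (x : ℝ), ∀ t ∈ Set.uIoc 0 y, ‖h (x + t * Complex.I)‖ ≤ M)
    (hr : ∀ t : ℝ, Filter.Tendsto (fun N : ℕ => h (((N : ℝ) : ℂ) + t * Complex.I)) Filter.atTop
      (nhds 0))
    (hl : ∀ t : ℝ, Filter.Tendsto (fun N : ℕ => h (((-(N : ℝ) : ℝ) : ℂ) + t * Complex.I))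
      Filter.atTop (nhds 0)) :
    ∫ x : ℝ, h x = ∫ x : ℝ, h (x + y * Complex.I) := by
  have hN : Filter.Tendsto (fun N : ℕ => (N : ℝ)) Filter.atTop Filter.atTop :=
    tendsto_natCast_atTop_atTop
  have hNn : Filter.Tendsto (fun N : ℕ => -(N : ℝ)) Filter.atTop Filter.atBot :=
    Filter.tendsto_neg_atTop_atBot.comp hN
  have l1 := intervalIntegral_tendsto_integral h0 hNn hN
  have l2 := intervalIntegral_tendsto_integral hy hNn hN
  have side : ∀ v : ℕ → ℝ, (∀ t : ℝ, Filter.Tendsto (fun N : ℕ => h ((v N : ℂ) + t * Complex.I))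
      Filter.atTop (nhds 0)) → Filter.Tendsto
      (fun N : ℕ => Complex.I • ∫ t in (0 : ℝ)..y, h ((v N : ℂ) + t * Complex.I)) Filter.atTop
      (nhds 0) := by
    intro v hv
    have h3 := intervalIntegral.tendsto_integral_filter_of_dominated_convergence
      (μ := volume) (a := 0) (b := y) (l := Filter.atTop)
      (F := fun (N : ℕ) (t : ℝ) => h ((v N : ℂ) + t * Complex.I)) (f := fun _ => 0)
      (fun _ => M) (Filter.Eventually.of_forall fun N =>
        (hd.continuous.comp (by fun_prop)).aestronglyMeasurable)
      (Filter.Eventually.of_forall fun N => Filter.Eventually.of_forall fun t ht => hM _ t ht)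
      intervalIntegrable_const (Filter.Eventually.of_forall fun t _ => hv t)
    have h4 := h3.const_smul Complex.I
    simpa using h4
  have l3 := side (fun N => (N : ℝ)) hr
  have l4 := side (fun N => -(N : ℝ)) hl
  have hz : ∀ N : ℕ, (∫ x in (-(N : ℝ))..N, h x) - (∫ x in (-(N : ℝ))..N, h (x + y * Complex.I)) +
      (Complex.I • ∫ t in (0 : ℝ)..y, h (((N : ℝ) : ℂ) + t * Complex.I)) -
      (Complex.I • ∫ t in (0 : ℝ)..y, h (((-(N : ℝ) : ℝ) : ℂ) + t * Complex.I)) = 0 := by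
    intro N
    have := Complex.integral_boundary_rect_eq_zero_of_differentiableOn h
      ((-(N : ℝ) : ℝ) : ℂ) (((N : ℝ) : ℂ) + y * Complex.I) hd.differentiableOn
    simpa using this
  have l5 := ((l1.sub l2).add l3).sub l4
  simp_rw [hz] at l5
  have := tendsto_nhds_unique l5 tendsto_const_nhds
  simpa [sub_eq_zero] using this

/-- The squared modulus of a function in the Paley-Wiener space has its spectrum in an interval. -/
theorem fourier_norm_sq_eq_zero {Δ : ℝ} (hΔ : 0 < Δ) {k : ℂ → ℂ} (hk : k ∈ PW (Real.pi * Δ))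
    {α : ℝ} (hα : Δ < |α|) : 𝓕 (fun x : ℝ => ((‖k x‖ ^ 2 : ℝ) : ℂ)) α = 0 := by
  have hpi := Real.pi_pos
  -- Strictly between `πΔ` and `π|α|`: the growth `exp(2σ|y|)` of the product loses to the decay
  -- `exp(-2π|α||y|)` of the shifted exponential.
  set σ := Real.pi * ((Δ + |α|) / 2) with hσ
  have hσ1 : Real.pi * Δ < σ := by rw [hσ]; gcongr; linarith
  have hσ2 : σ < Real.pi * |α| := by rw [hσ]; gcongr; linarith
  have hσ0 : 0 ≤ σ := by positivity
  obtain ⟨B, hB0, hB⟩ := exists_sum_norm_sq_le_of_mem_PW hσ0 hσ1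
  set D := B * ∫ x : ℝ, ‖k x‖ ^ 2 with hD
  have hD0 : 0 ≤ D := mul_nonneg hB0 (integral_nonneg fun _ => sq_nonneg _)
  have hsum : ∀ (F : Finset ℤ) (z : ℂ),
      ∑ j ∈ F, ‖k (z + j)‖ ^ 2 ≤ D * Real.exp (2 * σ * |z.im|) := hB k hk
  have hpt : ∀ z : ℂ, ‖k z‖ ^ 2 ≤ D * Real.exp (2 * σ * |z.im|) := fun z => by
    simpa using hsum {0} z
  have hline : ∀ y : ℝ, Integrable (fun x : ℝ => ‖k (x + y * Complex.I)‖ ^ 2) ∧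
      ∫ x : ℝ, ‖k (x + y * Complex.I)‖ ^ 2 ≤ D * Real.exp (2 * σ * |y|) := by
    intro y
    have := integrable_and_integral_le_of_sum_translates_le (L := 1)
      (D := D * Real.exp (2 * σ * |y|)) (g := fun x : ℝ => ‖k (x + y * Complex.I)‖ ^ 2)
      ((hk.1.continuous.comp (by fun_prop)).norm.pow 2) (fun _ => sq_nonneg _) one_pos
      (fun F x => by
        have := hsum F (x + y * Complex.I)
        simp only [Complex.add_im, Complex.ofReal_im, Complex.mul_im, Complex.ofReal_re,
          Complex.I_im, mul_one, Complex.I_re, mul_zero, add_zero, zero_add] at this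
        refine le_trans (le_of_eq (Finset.sum_congr rfl fun j _ => ?_)) this
        congr 3
        push_cast
        ring)
    simpa using this
  -- The entire extension of `|k|²` from the real line.
  set U : ℂ → ℂ := fun z => k z * conj (k (conj z)) with hU
  set h : ℂ → ℂ := fun z => Complex.exp (-2 * Real.pi * Complex.I * α * z) * U z with hh
  have hUd : Differentiable ℂ U := hk.1.mul (differentiable_conj_conj hk.1)
  have hhd : Differentiable ℂ h := (by fun_prop : Differentiable ℂ fun z : ℂ =>
    Complex.exp (-2 * Real.pi * Complex.I * α * z)).mul hUd
  have hen : ∀ x t : ℝ, ‖Complex.exp (-2 * Real.pi * Complex.I * α * (x + t * Complex.I))‖ =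
      Real.exp (2 * Real.pi * α * t) := by
    intro x t
    rw [Complex.norm_exp]
    congr 1
    simp
  have hcj : ∀ x t : ℝ, conj ((x : ℂ) + t * Complex.I) = x + ((-t : ℝ) : ℂ) * Complex.I := by
    intro x t
    simp
  have hUn : ∀ x t : ℝ, ‖U (x + t * Complex.I)‖ =
      ‖k (x + t * Complex.I)‖ * ‖k (x + ((-t : ℝ) : ℂ) * Complex.I)‖ := by
    intro x t
    simp only [hU]
    rw [norm_mul, RCLike.norm_conj, hcj]
  have hUle : ∀ x t : ℝ, ‖U (x + t * Complex.I)‖ ≤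
      (‖k (x + t * Complex.I)‖ ^ 2 + ‖k (x + ((-t : ℝ) : ℂ) * Complex.I)‖ ^ 2) / 2 := by
    intro x t
    rw [hUn]
    nlinarith [sq_nonneg (‖k (x + t * Complex.I)‖ - ‖k (x + ((-t : ℝ) : ℂ) * Complex.I)‖)]
  have hptl : ∀ x t : ℝ, ‖k (x + t * Complex.I)‖ ^ 2 ≤ D * Real.exp (2 * σ * |t|) := by
    intro x t
    simpa using hpt (x + t * Complex.I)
  have hUpt : ∀ x t : ℝ, ‖U (x + t * Complex.I)‖ ≤ D * Real.exp (2 * σ * |t|) := by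
    intro x t
    have h1 := hptl x t
    have h2 := hptl x (-t)
    rw [abs_neg] at h2
    linarith [hUle x t]
  have hUint : ∀ y : ℝ, Integrable (fun x : ℝ => U (x + y * Complex.I)) ∧
      ∫ x : ℝ, ‖U (x + y * Complex.I)‖ ≤ D * Real.exp (2 * σ * |y|) := by
    intro y
    have i1 := hline y
    have i2 := hline (-y)
    rw [abs_neg] at i2
    have i3 : Integrable fun x : ℝ =>
        (‖k (x + y * Complex.I)‖ ^ 2 + ‖k (x + ((-y : ℝ) : ℂ) * Complex.I)‖ ^ 2) / 2 :=
      (i1.1.add i2.1).div_const 2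
    have i4 : Integrable (fun x : ℝ => U (x + y * Complex.I)) :=
      Integrable.mono' i3 (hUd.continuous.comp (by fun_prop)).aestronglyMeasurable
        (Filter.Eventually.of_forall fun x => hUle x y)
    refine ⟨i4, (integral_mono i4.norm i3 fun x => hUle x y).trans ?_⟩
    rw [integral_div, integral_add i1.1 i2.1]
    linarith [i1.2, i2.2]
  have hhint : ∀ y : ℝ, Integrable fun x : ℝ => h (x + y * Complex.I) := by
    intro y
    exact (hUint y).1.bdd_mul (c := Real.exp (2 * Real.pi * α * y))
      (Continuous.aestronglyMeasurable (by fun_prop))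
      (Filter.Eventually.of_forall fun x => (hen x y).le)
  have hsummable : ∀ t : ℝ, Summable fun j : ℤ => ‖k (t * Complex.I + j)‖ ^ 2 := fun t =>
    summable_of_sum_le (fun _ => sq_nonneg _) fun F => hsum F _
  -- The vertical sides of the rectangles stand at integers, where summability of the squares over
  -- integer translates gives decay.
  have hdecay : ∀ t : ℝ, Filter.Tendsto (fun j : ℤ => h ((j : ℂ) + t * Complex.I)) Filter.cofinite
      (nhds 0) := by
    intro t
    have d1 := (hsummable t).tendsto_cofinite_zero
    have d2 := (hsummable (-t)).tendsto_cofinite_zero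
    have d3 := ((d1.add d2).div_const 2).const_mul (Real.exp (2 * Real.pi * α * t))
    simp only [add_zero, zero_div, mul_zero] at d3
    refine squeeze_zero_norm (fun j => ?_) d3
    have e1 := hen (j : ℝ) t
    have e2 := hUle (j : ℝ) t
    simp only [hh, norm_mul]
    push_cast at e1 e2 ⊢
    rw [e1, add_comm ((t : ℂ) * Complex.I), add_comm (-(t : ℂ) * Complex.I)]
    gcongr
  have hshift : ∀ y : ℝ, ∫ x : ℝ, h x = ∫ x : ℝ, h (x + y * Complex.I) := by
    intro y
    refine integral_eq_integral_add_mul_I hhd (by simpa using hhint 0) (hhint y)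
      (M := Real.exp (2 * Real.pi * |α| * |y|) * (D * Real.exp (2 * σ * |y|))) ?_ ?_ ?_
    · intro x t ht
      have ht' : |t| ≤ |y| := by
        have := Set.uIoc_subset_uIcc ht
        simpa using Set.abs_sub_left_of_mem_uIcc this
      simp only [hh, norm_mul]
      rw [hen]
      refine mul_le_mul (Real.exp_le_exp.2 ?_) ((hUpt x t).trans (by gcongr)) (norm_nonneg _)
        (Real.exp_pos _).le
      have h1 : α * t ≤ |α| * |y| :=
        (le_abs_self _).trans (by rw [abs_mul]; gcongr)
      nlinarith
    · intro t
      have hi : Function.Injective fun N : ℕ => (N : ℤ) := Nat.cast_injective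
      have := (hdecay t).comp hi.tendsto_cofinite
      rw [Nat.cofinite_eq_atTop] at this
      simpa [Function.comp_def] using this
    · intro t
      have hi : Function.Injective fun N : ℕ => -(N : ℤ) := fun a b hab => by simpa using hab
      have := (hdecay t).comp hi.tendsto_cofinite
      rw [Nat.cofinite_eq_atTop] at this
      simpa [Function.comp_def] using this
  have hle : ∀ y : ℝ, ‖∫ x : ℝ, h x‖ ≤ D * Real.exp (2 * Real.pi * α * y + 2 * σ * |y|) := by
    intro y
    rw [hshift y]
    refine (norm_integral_le_integral_norm _).trans ?_
    simp only [hh, norm_mul, hen]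
    rw [integral_const_mul, Real.exp_add, mul_left_comm]
    gcongr
    exact (hUint y).2
  -- The contour goes to infinity in the half-plane selected by the sign of `α`.
  have hzero : ∫ x : ℝ, h x = 0 := by
    have hlim : Filter.Tendsto (fun Y : ℝ => D * Real.exp (-((2 * Real.pi * |α| - 2 * σ) * Y)))
        Filter.atTop (nhds 0) := by
      have h1 : Filter.Tendsto (fun Y : ℝ => (2 * Real.pi * |α| - 2 * σ) * Y) Filter.atTop
          Filter.atTop := Filter.tendsto_id.const_mul_atTop (by linarith)
      have := (Real.tendsto_exp_neg_atTop_nhds_zero.comp h1).const_mul D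
      simpa using this
    have : ‖∫ x : ℝ, h x‖ ≤ 0 := by
      refine ge_of_tendsto hlim ?_
      filter_upwards [Filter.eventually_ge_atTop 0] with Y hY
      rcases le_total 0 α with hα0 | hα0
      · refine (hle (-Y)).trans (le_of_eq ?_)
        rw [abs_neg, abs_of_nonneg hY, abs_of_nonneg hα0]
        ring_nf
      · refine (hle Y).trans (le_of_eq ?_)
        rw [abs_of_nonneg hY, abs_of_nonpos hα0]
        ring_nf
    exact norm_le_zero_iff.1 this
  rw [Real.fourier_real_eq_integral_exp_smul, ← hzero]
  congr 1
  ext x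
  simp only [hh, hU, smul_eq_mul, Complex.conj_ofReal]
  rw [Complex.mul_conj, Complex.normSq_eq_norm_sq]
  congr 2
  push_cast
  ring

/-! ### The test function and the extremal constant -/

/-- The functional `Φ_ν` expressed through the Fourier transform of the measure. -/
theorem phi_eq {Δ : ℝ} (ν : Measure ℝ) [IsFiniteMeasure ν] (hν : ν (Set.Icc (-Δ) Δ)ᶜ = 0)
    {g : ℝ → ℝ} (hg : Integrable g) :
    phi Δ ν g = (∫ x : ℝ, (g x : ℂ) * measureFourier ν x).re := by
  have hr : ν.restrict (Set.Icc (-Δ) Δ) = ν := Measure.restrict_eq_self_of_ae_mem (by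
    rw [ae_iff]; exact hν)
  have hgc : Integrable fun x : ℝ => (g x : ℂ) := hg.ofReal
  have hprod : Integrable (Function.uncurry fun (α x : ℝ) =>
      Complex.exp (-2 * Real.pi * Complex.I * x * α) * (g x : ℂ)) (ν.prod volume) :=
    (hgc.comp_snd ν).bdd_mul (c := 1) (Continuous.aestronglyMeasurable (by fun_prop))
      (Filter.Eventually.of_forall fun p => (norm_exp_fourier p.2 p.1).le)
  have hF : ∀ α : ℝ, 𝓕 (fun x : ℝ => (g x : ℂ)) α =
      ∫ x : ℝ, Complex.exp (-2 * Real.pi * Complex.I * x * α) * (g x : ℂ) := by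
    intro α
    rw [Real.fourier_real_eq_integral_exp_smul]
    congr 1
    ext x
    rw [smul_eq_mul]
    congr 2
    push_cast
    ring
  have hFi : Integrable (𝓕 (fun x : ℝ => (g x : ℂ))) ν := by
    have := hprod.integral_prod_left
    refine this.congr (Filter.Eventually.of_forall fun α => ?_)
    simp only [hF, Function.uncurry]
  have hswap : ∫ α, 𝓕 (fun x : ℝ => (g x : ℂ)) α ∂ν =
      ∫ x : ℝ, (g x : ℂ) * measureFourier ν x := by
    simp_rw [hF]
    rw [integral_integral_swap hprod]
    congr 1
    ext x
    rw [integral_mul_const, measureFourier, mul_comm]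
  rw [phi, hr, ← hswap]
  exact integral_re hFi

/-- The even part of `|k|²` on the real line. -/
noncomputable def evenNormSq (k : ℂ → ℂ) (x : ℝ) : ℝ :=
  (‖k x‖ ^ 2 + ‖k (-x)‖ ^ 2) / 2

theorem integrable_evenNormSq {τ : ℝ} {k : ℂ → ℂ} (hk : k ∈ PW τ) : Integrable (evenNormSq k) :=
  ((integrable_norm_sq_of_mem_PW hk).add
    (integrable_norm_sq_of_mem_PW (comp_neg_mem_PW hk))).div_const 2

theorem fourier_evenNormSq_eq_zero {Δ : ℝ} (hΔ : 0 < Δ) {k : ℂ → ℂ} (hk : k ∈ PW (Real.pi * Δ))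
    {α : ℝ} (hα : α ∉ Set.Icc (-Δ) Δ) : 𝓕 (fun x : ℝ => (evenNormSq k x : ℂ)) α = 0 := by
  have hα' : Δ < |α| := by
    by_contra! h
    exact hα (abs_le.1 h)
  have h1 := fourier_norm_sq_eq_zero hΔ hk hα'
  have h2 := fourier_norm_sq_eq_zero hΔ (comp_neg_mem_PW hk) hα'
  rw [Real.fourier_real_eq_integral_exp_smul] at h1 h2 ⊢
  have hi : ∀ f ∈ PW (Real.pi * Δ), Integrable fun x : ℝ =>
      Complex.exp (((-2 * Real.pi * x * α : ℝ) : ℂ) * Complex.I) • ((‖f x‖ ^ 2 : ℝ) : ℂ) := by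
    intro f hf
    refine (integrable_norm_sq_of_mem_PW hf).ofReal.bdd_mul (c := 1)
      (Continuous.aestronglyMeasurable (by fun_prop)) (Filter.Eventually.of_forall fun x => ?_)
    rw [Complex.norm_exp_ofReal_mul_I]
  have h3 := congrArg (fun z : ℂ => z / 2)
    ((integral_add (hi k hk) (hi _ (comp_neg_mem_PW hk))).trans (by rw [h1, h2, add_zero]))
  simp only [zero_div] at h3
  rw [← integral_div] at h3
  rw [← h3]
  congr 1
  ext x
  simp only [smul_eq_mul, evenNormSq]
  push_cast
  ring

/-- The sign condition holds with equality, and the transform is integrable because it is continuous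
with compact support. -/
theorem cohnElkiesClass_evenNormSq {Δ : ℝ} (hΔ : 0 < Δ) {k : ℂ → ℂ} (hk : k ∈ PW (Real.pi * Δ)) :
    CohnElkiesClass Δ (evenNormSq k) where
  continuous := by
    have h1 : Continuous fun x : ℝ => ‖k x‖ ^ 2 :=
      (hk.1.continuous.comp Complex.continuous_ofReal).norm.pow 2
    have h2 : Continuous fun x : ℝ => ‖k (-x)‖ ^ 2 :=
      (hk.1.continuous.comp Complex.continuous_ofReal.neg).norm.pow 2
    exact (h1.add h2).div_const 2
  even x := by
    simp only [evenNormSq]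
    push_cast
    rw [neg_neg, add_comm]
  integrable := integrable_evenNormSq hk
  integrable_fourier := by
    have hc : Continuous (𝓕 (fun x : ℝ => (evenNormSq k x : ℂ))) :=
      VectorFourier.fourierIntegral_continuous
      Real.continuous_fourierChar (innerSL ℝ).continuous₂ (integrable_evenNormSq hk).ofReal
    exact hc.integrable_of_hasCompactSupport (HasCompactSupport.intro isCompact_Icc
      fun α hα => fourier_evenNormSq_eq_zero hΔ hk hα)
  fourier_nonpos α hα := by
    rw [realFourier, fourier_evenNormSq_eq_zero hΔ hk hα, Complex.zero_re]
  nonneg x := by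
    simp only [evenNormSq]
    positivity

/-- The reflection `x ↦ -x` conjugates `ν̂`, so symmetrizing `|k|²` averages `nuNormSq` with its
conjugate. -/
theorem phi_evenNormSq {Δ : ℝ} (ν : Measure ℝ) [IsFiniteMeasure ν]
    (hν : ν (Set.Icc (-Δ) Δ)ᶜ = 0) {τ : ℝ} {k : ℂ → ℂ} (hk : k ∈ PW τ) :
    phi Δ ν (evenNormSq k) = (nuNormSq ν k).re := by
  rw [phi_eq ν hν (integrable_evenNormSq hk)]
  have hi : ∀ f ∈ PW τ, Integrable fun x : ℝ => ((‖f x‖ ^ 2 : ℝ) : ℂ) * measureFourier ν x :=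
    fun f hf => integrable_mul_measureFourier ν (integrable_norm_sq_of_mem_PW hf).ofReal
  have h1 : ∫ x : ℝ, ((‖k (-x)‖ ^ 2 : ℝ) : ℂ) * measureFourier ν x = conj (nuNormSq ν k) := by
    rw [nuNormSq, ← integral_conj, ← integral_neg_eq_self]
    congr 1
    ext x
    rw [map_mul, conj_measureFourier, Complex.conj_ofReal]
    simp
  have h2 : ∫ x : ℝ, (evenNormSq k x : ℂ) * measureFourier ν x =
      (nuNormSq ν k + conj (nuNormSq ν k)) / 2 := by
    rw [← h1, nuNormSq, ← integral_add (hi k hk) (hi _ (comp_neg_mem_PW hk)), ← integral_div]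
    congr 1
    ext x
    simp only [evenNormSq]
    push_cast
    ring
  rw [h2, Complex.add_conj]
  simp

namespace EquivalentNorm

variable (d : EquivalentNorm)

theorem reproducingKernel_zero_zero :
    reproducingKernel d.Space 0 0 = ((‖RKHS.kerFun d.Space 0 (1 : ℂ)‖ ^ 2 : ℝ) : ℂ) := by
  have h := RKHS.kerFun_inner (H := d.Space) (0 : ℂ) (1 : ℂ) (RKHS.kerFun d.Space 0 (1 : ℂ))
  rw [inner_self_eq_norm_sq_to_K] at h
  rw [reproducingKernel]
  simpa using h.symm

/-- A zero kernel would make every function of the space vanish at `0`. -/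
theorem kerFun_zero_ne_zero : RKHS.kerFun d.Space 0 (1 : ℂ) ≠ 0 := by
  intro h0
  obtain ⟨f, hf, hf0⟩ := exists_mem_PW_apply_zero_ne_zero d.pi_mul_pos
  obtain ⟨g, rfl⟩ := d.exists_incl_eq hf
  have h := RKHS.kerFun_inner (H := d.Space) (0 : ℂ) (1 : ℂ) g
  rw [h0, inner_zero_left] at h
  apply hf0
  rw [← coe_eq]
  simpa using h.symm

/-- The even part of `|K|²` has `Φ_ν = ‖K‖²` and value `‖K‖⁴` at `0`, and `‖K‖² = K(0,0)`. -/
theorem extremalConst_le (hν : d.ν (Set.Icc (-d.Δ) d.Δ)ᶜ = 0) :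
    extremalConst d.Δ d.ν ≤ ((1 / (reproducingKernel d.Space 0 0).re : ℝ) : EReal) := by
  set K := RKHS.kerFun d.Space 0 (1 : ℂ) with hK
  have hK0 : 0 < ‖K‖ := norm_pos_iff.2 d.kerFun_zero_ne_zero
  have hmem := d.incl_mem K
  have hre : _ = ((‖K‖ ^ 2 : ℝ) : ℂ) := d.reproducingKernel_zero_zero
  have hval : d.incl K 0 = ((‖K‖ ^ 2 : ℝ) : ℂ) := by
    rw [← hre, ← coe_eq]
    rfl
  have hg0 : evenNormSq (d.incl K) 0 = (‖K‖ ^ 2) ^ 2 := by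
    simp only [evenNormSq, Complex.ofReal_zero, neg_zero]
    rw [hval, Complex.norm_real, Real.norm_of_nonneg (sq_nonneg _)]
    ring
  refine sInf_le ⟨evenNormSq (d.incl K), cohnElkiesClass_evenNormSq d.Δ_pos hmem, ?_, ?_⟩
  · rw [hg0]
    positivity
  · rw [phi_evenNormSq d.ν hν hmem, ← norm_sq_eq, hg0, hre, Complex.ofReal_re]
    congr 1
    field_simp

end EquivalentNorm

end PaleyWiener

theorem mainTheorem8 (Δ : ℝ) (hΔ : 0 < Δ)
    (ν : MeasureTheory.Measure ℝ) [MeasureTheory.IsFiniteMeasure ν]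
    (hν : ν (Set.Icc (-Δ) Δ)ᶜ = 0)
    (a b : ℝ) (ha : 0 < a) (hb : 0 < b)
    (hnorm : ∀ f ∈ PaleyWiener.PW (Real.pi * Δ),
      (PaleyWiener.nuNormSq ν f).im = 0 ∧
      a * PaleyWiener.l2Norm f ≤ PaleyWiener.nuNorm ν f ∧
      PaleyWiener.nuNorm ν f ≤ b * PaleyWiener.l2Norm f) :
    PaleyWiener.nuSpace Δ ν = PaleyWiener.PW (Real.pi * Δ) ∧
    ∃ (H : Type) (_ : NormedAddCommGroup H) (_ : InnerProductSpace ℂ H) (_ : CompleteSpace H)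
      (_ : RKHS ℂ H ℂ ℂ),
      Set.range (fun f : H => (f : ℂ → ℂ)) = PaleyWiener.nuSpace Δ ν ∧
      (∀ f g : H, inner ℂ g f = PaleyWiener.nuForm ν f g) ∧
      (∀ f : H, ‖f‖ = PaleyWiener.nuNorm ν f) ∧
      (PaleyWiener.reproducingKernel H 0 0).im = 0 ∧
      0 < (PaleyWiener.reproducingKernel H 0 0).re ∧
      PaleyWiener.extremalConst Δ ν ≤
        ((1 / (PaleyWiener.reproducingKernel H 0 0).re : ℝ) : EReal) := by
  let d : PaleyWiener.EquivalentNorm := ⟨Δ, hΔ, ν, inferInstance, a, b, ha, hb, hnorm⟩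
  have hspace : PaleyWiener.nuSpace Δ ν = PaleyWiener.PW (Real.pi * Δ) :=
    PaleyWiener.nuSpace_eq_PW hΔ ν hν ha fun f hf => (hnorm f hf).2.1
  have hker := d.reproducingKernel_zero_zero
  refine ⟨hspace, d.Space, inferInstance, inferInstance, inferInstance, inferInstance,
    ?_, fun f g => rfl, fun f => d.norm_eq f, ?_, ?_, d.extremalConst_le hν⟩
  · rw [hspace]
    ext f
    exact ⟨fun ⟨g, hg⟩ => hg ▸ d.incl_mem g, fun hf => d.exists_incl_eq hf⟩
  · rw [hker, Complex.ofReal_im]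
  · rw [hker, Complex.ofReal_re]
    exact pow_pos (norm_pos_iff.2 d.kerFun_zero_ne_zero) 2
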